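/- Let $\mathfrak{A}$ be a von Neumann algebra on a complex Hilbert space $\mathcal{H}$, and let $\Psi,\Phi\in\mathcal{H}$ be unit vectors that are cyclic and separating for $\mathfrak{A}$. Let $S_{\Psi|\Phi}$ be the relative Tomita operator, that is, the closure of the antilinear map $a\Psi\mapsto a^\dagger\Phi$, $a\in\mathfrak{A}$, let $\Delta_{\Psi|\Phi}=S_{\Psi|\Phi}^\dagger S_{\Psi|\Phi}$ be the relative modular operator and $(E_\lambda)$ its spectral resolution, and put $\mathrm{d}\mu(\lambda)=\mathrm{d}\langle\Psi,E_\lambda\Psi\rangle$. For $\alpha\in[0,1)$ the Petz--Rényi relative entropy is $$\mathcal{S}_\alpha(\Psi\Vert\Phi)=\frac{1}{\alpha-1}\ln\int_0^\infty\lambda^{1-\alpha}\,\mathrm{d}\mu(\lambda),$$ and $\mathcal{S}_1(\Psi\Vert\Phi):=\lim_{\alpha\to1^-}\mathcal{S}_\alpha(\Psi\Vert\Phi)$ in $[-\infty,\infty]$. The Araki--Uhlmann relative entropy is $\mathcal{S}(\Psi\Vert\Phi)=-\langle\Psi,\ln\Delta_{\Psi|\Phi}\Psi\rangle=-\int_0^\infty\ln\lambda\,\mathrm{d}\mu(\lambda)\in(-\infty,\infty]$.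 Then: 1. $\mathcal{S}_\alpha(\Psi\Vert\Phi)$ is well defined for $\alpha\in[0,1]$: the map $a\Psi\mapsto a^\dagger\Phi$ is closable, $\Delta_{\Psi|\Phi}$ has a unique spectral resolution and it is concentrated on $(0,\infty)$, the integral $\int_0^\infty\lambda^{1-\alpha}\,\mathrm{d}\mu$ is finite and strictly positive for $\alpha\in[0,1]$, and the limit defining $\mathcal{S}_1$ exists. 2. $\alpha\mapsto\mathcal{S}_\alpha(\Psi\Vert\Phi)$ is continuous on $[0,1)$ and differentiable on $(0,1)$. At $\alpha=0$ the limit of the right difference quotients exists in the extended reals and equals $\int_0^\infty\lambda\ln\lambda\,\mathrm{d}\mu(\lambda)\in(-\infty,\infty]$; $\mathcal{S}_\alpha$ is (one-sidedly) differentiable at $\alpha=0$, hence differentiable on $[0,1)$, if and only if $\lambda\ln\lambda$ is $\mu$-integrable. 3. $\mathcal{S}_0(\Psi\Vert\Phi)=0$, $\mathcal{S}_\alpha(\Psi\Vert\Phi)$ is monotonically increasing (not necessarily strictly) in $\alpha\in[0,1]$, and $\mathcal{S}_\alpha(\Psi\Vert\Phi)\ge0$ for all $\alpha\in[0,1]$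 (the value at $\alpha=1$ may be $+\infty$). 4. $\lim_{\alpha\to1^-}\mathcal{S}_\alpha(\Psi\Vert\Phi)=\mathcal{S}_1(\Psi\Vert\Phi)=\mathcal{S}(\Psi\Vert\Phi)$, and $\mathcal{S}_\alpha(\Psi\Vert\Phi)\le\mathcal{S}(\Psi\Vert\Phi)$ for all $\alpha\in[0,1]$. 5. The operators $\Delta_{\Psi|\Phi}^{\mathrm{i}t}$ defined by functional calculus exist for all $t\in\mathbb{R}$, that is, they are bounded and $\langle x,\Delta_{\Psi|\Phi}^{\mathrm{i}t}x\rangle=\int_0^\infty\lambda^{\mathrm{i}t}\,\mathrm{d}\langle x,E_\lambda x\rangle$ for all $x\in\mathcal{H}$. The function $t\mapsto\langle\Psi,\Delta_{\Psi|\Phi}^{\mathrm{i}t}\Psi\rangle$ on $\mathbb{R}$ has a unique continuous extension $F$ to $\{-1\le\operatorname{Im}z\le0\}$ that is analytic in $-1<\operatorname{Im}z<0$. It satisfies $F(\mathrm{i}(\alpha-1))=\int_0^\infty\lambda^{1-\alpha}\,\mathrm{d}\mu(\lambda)$ for $\alpha\in[0,1]$, and hence $\mathcal{S}_\alpha(\Psi\Vert\Phi)=\frac{1}{\alpha-1}\ln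 F(\mathrm{i}(\alpha-1))$ for $\alpha\in[0,1)$. -/

import Mathlib

open Filter Topology MeasureTheory Set
open scoped ComplexInnerProductSpace

noncomputable section

namespace PetzRenyi

variable {H : Type*} [NormedAddCommGroup H] [InnerProductSpace ℂ H] [CompleteSpace H]

/-! ### Vectors and von Neumann algebras -/

/-- `Ψ` is cyclic for `A`: the set `{a Ψ | a ∈ A}` is dense. -/
def IsCyclic (A : VonNeumannAlgebra H) (Ψ : H) : Prop :=
  Dense {x : H | ∃ a ∈ A, x = a Ψ}

/-- `Ψ` is separating for `A`: `a Ψ = 0` with `a ∈ A` implies `a = 0`. -/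
def IsSeparating (A : VonNeumannAlgebra H) (Ψ : H) : Prop :=
  ∀ a ∈ A, a Ψ = 0 → a = 0

/-! ### The relative Tomita operator and the relative modular operator -/

/-- The graph of the map `a Ψ ↦ a† Φ`, `a ∈ A`. -/
def preTomitaGraph (A : VonNeumannAlgebra H) (Ψ Φ : H) : AddSubgroup (H × H) where
  carrier := {p | ∃ a ∈ A, p = (a Ψ, (star a) Φ)}
  zero_mem' := ⟨0, zero_mem A, by ext <;> simp⟩
  add_mem' := by
    rintro _ _ ⟨a, ha, rfl⟩ ⟨b, hb, rfl⟩
    exact ⟨a + b, add_mem ha hb, by simp⟩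
  neg_mem' := by
    rintro _ ⟨a, ha, rfl⟩
    exact ⟨-a, neg_mem ha, by simp⟩

/-- The graph of the (antilinear) relative Tomita operator `S_{Ψ|Φ}`, the closure of the map
`a Ψ ↦ a† Φ`. -/
def tomitaGraph (A : VonNeumannAlgebra H) (Ψ Φ : H) : AddSubgroup (H × H) :=
  (preTomitaGraph A Ψ Φ).topologicalClosure

/-- The graph of the adjoint `S†` of an antilinear operator `S` with graph `G`:
`S† y = z` if and only if `⟪u, z⟫ = ⟪y, S u⟫` for all `u` in the domain of `S`. -/
def antilinearAdjointGraph (G : AddSubgroup (H × H)) : Set (H × H) :=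
  {p | ∀ q ∈ G, ⟪q.1, p.2⟫ = ⟪p.1, q.2⟫}

theorem tomitaGraph_smul (A : VonNeumannAlgebra H) (Ψ Φ : H) (c : ℂ) (x y : H)
    (h : (x, y) ∈ tomitaGraph A Ψ Φ) :
    (c • x, (starRingEnd ℂ) c • y) ∈ tomitaGraph A Ψ Φ := by
  have hc : Continuous fun p : H × H => (c • p.1, (starRingEnd ℂ) c • p.2) := by fun_prop
  refine map_mem_closure (f := fun p : H × H => (c • p.1, (starRingEnd ℂ) c • p.2)) hc h ?_
  rintro _ ⟨a, ha, rfl⟩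
  refine ⟨c • a, ?_, by simp [star_smul]⟩
  exact A.toStarSubalgebra.smul_mem ha c

/-- The graph of the (complex linear) relative modular operator `S_{Ψ|Φ}† S_{Ψ|Φ}`. -/
def modularGraph (A : VonNeumannAlgebra H) (Ψ Φ : H) : Submodule ℂ (H × H) where
  carrier := {p | ∃ y, (p.1, y) ∈ tomitaGraph A Ψ Φ ∧
    (y, p.2) ∈ antilinearAdjointGraph (tomitaGraph A Ψ Φ)}
  zero_mem' := ⟨0, (tomitaGraph A Ψ Φ).zero_mem, fun q _ => by simp⟩
  add_mem' := by
    rintro p p' ⟨y, h1, h2⟩ ⟨y', h1', h2'⟩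
    refine ⟨y + y', (tomitaGraph A Ψ Φ).add_mem h1 h1', fun q hq => ?_⟩
    have e := h2 q hq
    have e' := h2' q hq
    simp only [Prod.snd_add, inner_add_left, inner_add_right] at *
    rw [e, e']
  smul_mem' := by
    rintro c p ⟨y, h1, h2⟩
    refine ⟨(starRingEnd ℂ) c • y, tomitaGraph_smul A Ψ Φ c _ _ h1, fun q hq => ?_⟩
    have e := h2 q hq
    simp only [Prod.smul_snd, inner_smul_left, inner_smul_right, Complex.conj_conj] at *
    rw [e]

/-- The relative modular operator `Δ_{Ψ|Φ} = S_{Ψ|Φ}† S_{Ψ|Φ}`, the square of the positive part in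
the polar decomposition of `S_{Ψ|Φ}`. -/
def modularOperator (A : VonNeumannAlgebra H) (Ψ Φ : H) : H →ₗ.[ℂ] H :=
  (modularGraph A Ψ Φ).toLinearPMap

/-! ### Spectral resolutions -/

variable (H) in
/-- A resolution of the identity `(E_l)_{l ∈ ℝ}`: an increasing, strongly right-continuous family
of orthogonal projections, strongly convergent to `0` at `-∞` and to `1` at `+∞`. -/
@[ext]
structure SpectralFamily where
  proj : ℝ → (H →L[ℂ] H)
  isStarProjection : ∀ l, IsStarProjection (proj l)
  mul_of_le : ∀ k l, k ≤ l → proj k * proj l = proj k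
  right_cont : ∀ l x, Tendsto (fun k => proj k x) (𝓝[>] l) (𝓝 (proj l x))
  tendsto_atBot : ∀ x, Tendsto (fun l => proj l x) atBot (𝓝 0)
  tendsto_atTop : ∀ x, Tendsto (fun l => proj l x) atTop (𝓝 x)

namespace SpectralFamily

theorem inner_eq (E : SpectralFamily H) (l : ℝ) (x : H) :
    (⟪x, E.proj l x⟫).re = ‖E.proj l x‖ ^ 2 := by
  have h1 : E.proj l (E.proj l x) = E.proj l x := by
    have := (E.isStarProjection l).isIdempotentElem
    exact congrArg (fun T : H →L[ℂ] H => T x) this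
  have h2 : ⟪E.proj l x, E.proj l x⟫ = ⟪x, E.proj l (E.proj l x)⟫ := by
    have := (E.isStarProjection l).isSelfAdjoint
    rw [ContinuousLinearMap.isSelfAdjoint_iff'] at this
    conv_rhs => rw [← ContinuousLinearMap.adjoint_inner_left, this]
  rw [h1] at h2
  rw [← h2, inner_self_eq_norm_sq_to_K]
  norm_cast

theorem inner_mono (E : SpectralFamily H) (x : H) :
    Monotone fun l => (⟪x, E.proj l x⟫).re := by
  intro k l hkl
  have h1 : E.proj k x = E.proj k (E.proj l x) :=
    (congrArg (fun T : H →L[ℂ] H => T x) (E.mul_of_le k l hkl)).symm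
  have h2 : ‖E.proj k (E.proj l x)‖ ≤ ‖E.proj l x‖ := by
    have h3 : ‖E.proj k‖ ≤ 1 := (E.isStarProjection k).norm_le
    simpa using (E.proj k).le_of_opNorm_le h3 (E.proj l x)
  simp only [inner_eq]
  rw [h1]
  gcongr

/-- The function `l ↦ ⟨x, E_l x⟩`. -/
def stieltjes (E : SpectralFamily H) (x : H) : StieltjesFunction ℝ where
  toFun l := (⟪x, E.proj l x⟫).re
  mono' := E.inner_mono x
  right_continuous' l := by
    rw [← continuousWithinAt_Ioi_iff_Ici]
    have h : Continuous fun y : H => (⟪x, y⟫).re := by fun_prop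
    exact (h.tendsto _).comp (E.right_cont l x)

/-- The measure `d⟨x, E_l x⟩` on the real line. -/
def measure (E : SpectralFamily H) (x : H) : Measure ℝ :=
  (E.stieltjes x).measure

/-- `E` is the spectral resolution of the operator `T`, that is `T = ∫ l dE_l`:
the domain of `T` is `{x | ∫ l ^ 2 d⟨x, E_l x⟩ < ∞}`, and `⟨x, T x⟩ = ∫ l d⟨x, E_l x⟩` there. -/
def IsResolutionOf (E : SpectralFamily H) (T : H →ₗ.[ℂ] H) : Prop :=
  (∀ x : H, x ∈ T.domain ↔ Integrable (fun l : ℝ => l ^ 2) (E.measure x)) ∧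
  ∀ x : T.domain, ⟪(x : H), T x⟫ = ((∫ l, l ∂(E.measure (x : H)) : ℝ) : ℂ)

end SpectralFamily

open Classical in
/-- The spectral measure `d⟨x, E_l x⟩`, where `E` is the spectral resolution of `T`
(zero if `T` has none). -/
def spectralMeasure (T : H →ₗ.[ℂ] H) (x : H) : Measure ℝ :=
  if h : ∃ E : SpectralFamily H, E.IsResolutionOf T then h.choose.measure x else 0

open Classical in
/-- For a positive injective operator `T`, the operator `g(T) = ∫_0^∞ g(l) dE_l` of the functional
calculus for a bounded function `g`: the bounded operator with
`⟨x, g(T) x⟩ = ∫_0^∞ g(l) d⟨x, E_l x⟩` for all `x` (zero if there is none). -/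
def functionalCalculus (T : H →ₗ.[ℂ] H) (g : ℝ → ℂ) : H →L[ℂ] H :=
  if h : ∃ U : H →L[ℂ] H, ∀ x, ⟪x, U x⟫ = ∫ l in Ioi (0 : ℝ), g l ∂(spectralMeasure T x)
  then h.choose else 0

/-! ### Relative entropies -/

/-- The measure `d⟨Ψ, E_l Ψ⟩` with `E` the spectral resolution of `Δ_{Ψ|Φ}`. -/
def modularMeasure (A : VonNeumannAlgebra H) (Ψ Φ : H) : Measure ℝ :=
  spectralMeasure (modularOperator A Ψ Φ) Ψ

/-- `∫_0^∞ l ^ r d⟨Ψ, E_l Ψ⟩`. -/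
def modularMoment (A : VonNeumannAlgebra H) (Ψ Φ : H) (r : ℝ) : ℝ :=
  ∫ l in Ioi (0 : ℝ), l ^ r ∂(modularMeasure A Ψ Φ)

/-- The Petz–Rényi relative entropy `(α - 1)⁻¹ ln ∫_0^∞ l ^ (1 - α) d⟨Ψ, E_l Ψ⟩` for `α ≠ 1`. -/
def petzRenyi (A : VonNeumannAlgebra H) (Ψ Φ : H) (α : ℝ) : ℝ :=
  (α - 1)⁻¹ * Real.log (modularMoment A Ψ Φ (1 - α))

/-- The extended-real valued Petz–Rényi relative entropy, with its value at `α = 1` defined as the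
limit `α → 1⁻`. -/
def petzRenyiExt (A : VonNeumannAlgebra H) (Ψ Φ : H) (α : ℝ) : EReal :=
  if α = 1 then limUnder (𝓝[<] (1 : ℝ)) (fun β : ℝ => (petzRenyi A Ψ Φ β : EReal))
  else (petzRenyi A Ψ Φ α : EReal)

/-- The Araki–Uhlmann relative entropy `- ⟨Ψ, ln Δ_{Ψ|Φ} Ψ⟩ = - ∫_0^∞ ln l d⟨Ψ, E_l Ψ⟩`, as the
difference of the integrals of the positive and of the negative part of `- ln`. -/
def arakiUhlmann (A : VonNeumannAlgebra H) (Ψ Φ : H) : EReal :=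
  ((∫⁻ l in Ioi (0 : ℝ), ENNReal.ofReal (-Real.log l) ∂(modularMeasure A Ψ Φ) : ENNReal) : EReal) -
  ((∫⁻ l in Ioi (0 : ℝ), ENNReal.ofReal (Real.log l) ∂(modularMeasure A Ψ Φ) : ENNReal) : EReal)

/-- The relative modular flow `Δ_{Ψ|Φ} ^ {it}`. -/
def modularFlow (A : VonNeumannAlgebra H) (Ψ Φ : H) (t : ℝ) : H →L[ℂ] H :=
  functionalCalculus (modularOperator A Ψ Φ) (fun l => (l : ℂ) ^ (Complex.I * t))

/-- The open strip `-1 < Im z < 0`. -/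
def strip : Set ℂ := {z | -1 < z.im ∧ z.im < 0}

/-- `F` is an analytic continuation of `t ↦ ⟨Ψ, Δ_{Ψ|Φ} ^ {it} Ψ⟩` into the strip
`-1 < Im z < 0`, continuous up to the boundary. -/
def IsFlowContinuation (A : VonNeumannAlgebra H) (Ψ Φ : H) (F : ℂ → ℂ) : Prop :=
  DiffContOnCl ℂ F strip ∧ ∀ t : ℝ, F t = ⟪Ψ, modularFlow A Ψ Φ t Ψ⟫

end PetzRenyi

end

open Filter Topology MeasureTheory Set
open scoped ComplexInnerProductSpace

noncomputable section

namespace PetzRenyi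

variable {H : Type*} [NormedAddCommGroup H] [InnerProductSpace ℂ H] [CompleteSpace H]

/-! ### Integrals against families of finite measures -/

/-! All claims about the entropies reduce to a probability measure `μ` on `(0, ∞)` with `∫ l dμ =
1`. Its mass is `‖Ψ‖² = 1`. It does not charge `(-∞, 0]`, because `Δ = S† S` is strictly positive
when `Φ` is separating. Its first moment is `‖S Ψ‖² = ‖Φ‖² = 1`
(`integral_measure_of_mem_tomitaGraph`).

Spectral theory. Projecting `(x, 0)` orthogonally onto the closed graph of `S` gives `x = y + S† S
y`, and `x ↦ y` is the bounded resolvent `R = (1 + Δ)⁻¹`. Riesz–Markov applied to the continuous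
functional calculus of `R` gives spectral measures. Strong limits of powers of continuous functions
of `R` give spectral projections, which are reparametrized by `t ↦ t⁻¹ - 1`
(`exists_spectralFamily`, `exists_isResolutionOf`). Uniqueness holds because `T` determines `(T +
i)⁻¹`, and the star algebra generated by `t ↦ (t + i)⁻¹` separates points, hence measures
(`IsResolutionOf.unique`).

Scalar analysis. Let `M` be the moment generating function of `log` under `μ`, finite on `[0, 1]`.
With `β = 1 - α` the entropy is `-log (M β) / β`, a difference quotient of `-log M` at `0`. It is
monotone by Jensen (`neg_log_mgf_div_le`). Its limit as `β → 0` is the extended one-sided derivative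
`-∫ log l dμ` (`tendsto_neg_log_mgf_div`). The endpoint `α = 0` is the same situation for `-log`
under the probability measure `l dμ`, where the derivative becomes `∫ l log l dμ`.

Analytic continuation. `z ↦ ∫ exp (i z log l) dμ` is dominated by `1 + l` on the closed strip, so it
continues the flow and takes the value `M (1 - α)` at `i (α - 1)`. Two continuations agree because a
function that vanishes on one edge of a square, multiplied by its rotations, vanishes on the whole
boundary. -/

theorem ae_eq_zero_of_forall_setIntegral_Iic_eq_zero {ν : Measure ℝ} {f : ℝ → ℂ}
    (hf : Integrable f ν) (h : ∀ l, ∫ t in Iic l, f t ∂ν = 0) : f =ᵐ[ν] 0 := by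
  have htot : ∫ t, f t ∂ν = 0 := by
    have h1 := (aecover_Iic (μ := ν) (tendsto_natCast_atTop_atTop (R := ℝ))
      ).integral_tendsto_of_countably_generated hf
    simp only [h] at h1
    exact (tendsto_nhds_unique h1 tendsto_const_nhds)
  refine hf.ae_eq_zero_of_forall_setIntegral_eq_zero fun s hs _ => ?_
  clear * - hs hf h htot
  induction s, hs using MeasurableSpace.induction_on_inter
    (borel_eq_generateFrom_Iic ℝ ▸ BorelSpace.measurable_eq (α := ℝ)) isPiSystem_Iic with
  | empty => simp
  | basic t ht =>
    obtain ⟨l, rfl⟩ := ht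
    exact h l
  | compl t htm ih => rw [setIntegral_compl htm hf, ih, htot, sub_zero]
  | iUnion F hd hm ih =>
    rw [integral_iUnion hm hd hf.integrableOn]
    simp [ih]

/-- A linear relation between the distribution functions of finitely many complex measures
`d i • m i` carries over to integrals. -/
theorem sum_integral_mul_eq_zero {ι : Type*} [Fintype ι] (m : ι → Measure ℝ)
    [∀ i, IsFiniteMeasure (m i)] (d : ι → ℝ → ℂ) (hd : ∀ i, Integrable (d i) (m i))
    (h : ∀ l, ∑ i, ∫ t in Iic l, d i t ∂(m i) = 0) (g : ℝ → ℂ)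
    (hg : ∀ i, Integrable (fun t => g t * d i t) (m i)) :
    ∑ i, ∫ t, g t * d i t ∂(m i) = 0 := by
  classical
  -- Every `m i` has a density with respect to the sum, so the hypothesis concerns a single
  -- integrable function with zero integrals over all half-lines. That function is zero almost
  -- everywhere, and multiplying it by `g` changes nothing.
  set ν : Measure ℝ := ∑ i, m i with hν
  have hac : ∀ i, m i ≪ ν := fun i => Measure.absolutelyContinuous_of_le
    (Finset.single_le_sum (f := m) (fun _ _ => Measure.zero_le _) (Finset.mem_univ i))
  have hk : ∀ i, Integrable (fun t => ((m i).rnDeriv ν t).toReal • d i t) ν :=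
    fun i => (integrable_rnDeriv_smul_iff (hac i)).2 (hd i)
  have hgk : ∀ i, Integrable (fun t => ((m i).rnDeriv ν t).toReal • (g t * d i t)) ν :=
    fun i => (integrable_rnDeriv_smul_iff (hac i)).2 (hg i)
  have h0 := ae_eq_zero_of_forall_setIntegral_Iic_eq_zero (ν := ν)
    (f := fun t => ∑ i, ((m i).rnDeriv ν t).toReal • d i t)
    (integrable_finsetSum _ fun i _ => hk i) (fun l => by
      rw [integral_finsetSum _ fun i _ => (hk i).integrableOn, ← h l]
      exact Finset.sum_congr rfl fun i _ => setIntegral_rnDeriv_smul (hac i) measurableSet_Iic)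
  calc ∑ i, ∫ t, g t * d i t ∂(m i)
      = ∑ i, ∫ t, ((m i).rnDeriv ν t).toReal • (g t * d i t) ∂ν :=
        Finset.sum_congr rfl fun i _ => (integral_rnDeriv_smul (hac i)).symm
    _ = ∫ t, ∑ i, ((m i).rnDeriv ν t).toReal • (g t * d i t) ∂ν :=
        (integral_finsetSum _ fun i _ => hgk i).symm
    _ = ∫ _, 0 ∂ν := by
        refine integral_congr_ae (h0.mono fun t ht => ?_)
        simp only [Pi.zero_apply] at ht
        simp only [← mul_smul_comm, ← Finset.mul_sum, ht, mul_zero]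
    _ = 0 := integral_zero _ _

/-! ### Bounded measurable functions -/

/-- Bounded Borel functions on the real line. -/
def IsBddMeasurable (g : ℝ → ℂ) : Prop :=
  Measurable g ∧ ∃ C, ∀ t, ‖g t‖ ≤ C

namespace IsBddMeasurable

variable {g h : ℝ → ℂ}

theorem const (c : ℂ) : IsBddMeasurable fun _ => c := ⟨measurable_const, ‖c‖, fun _ => le_rfl⟩

theorem add (hg : IsBddMeasurable g) (hh : IsBddMeasurable h) :
    IsBddMeasurable fun t => g t + h t := by
  obtain ⟨mg, C, hC⟩ := hg
  obtain ⟨mh, D, hD⟩ := hh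
  exact ⟨mg.add mh, C + D, fun t => (norm_add_le _ _).trans (add_le_add (hC t) (hD t))⟩

theorem mul (hg : IsBddMeasurable g) (hh : IsBddMeasurable h) :
    IsBddMeasurable fun t => g t * h t := by
  obtain ⟨mg, C, hC⟩ := hg
  obtain ⟨mh, D, hD⟩ := hh
  refine ⟨mg.mul mh, C * D, fun t => (norm_mul _ _).le.trans ?_⟩
  exact mul_le_mul (hC t) (hD t) (norm_nonneg _) ((norm_nonneg _).trans (hC t))

theorem sub (hg : IsBddMeasurable g) (hh : IsBddMeasurable h) :
    IsBddMeasurable fun t => g t - h t := by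
  simpa [sub_eq_add_neg] using hg.add ((const (-1)).mul hh)

theorem conj (hg : IsBddMeasurable g) : IsBddMeasurable fun t => (starRingEnd ℂ) (g t) :=
  ⟨Complex.continuous_conj.measurable.comp hg.1, hg.2.imp fun C hC t => by simpa using hC t⟩

theorem indicator (hg : IsBddMeasurable g) {s : Set ℝ} (hs : MeasurableSet s) :
    IsBddMeasurable (s.indicator g) :=
  ⟨hg.1.indicator hs, hg.2.imp fun _ hC t => (norm_indicator_le_norm_self g t).trans (hC t)⟩

theorem integrable (hg : IsBddMeasurable g) (ν : Measure ℝ) [IsFiniteMeasure ν] :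
    Integrable g ν := by
  obtain ⟨mg, C, hC⟩ := hg
  exact Integrable.of_bound mg.aestronglyMeasurable C (ae_of_all _ hC)

theorem integrable_mul (hg : IsBddMeasurable g) {ν : Measure ℝ} (hh : Integrable h ν) :
    Integrable (fun t => g t * h t) ν := by
  obtain ⟨mg, C, hC⟩ := hg
  exact hh.bdd_mul mg.aestronglyMeasurable (ae_of_all _ hC)

end IsBddMeasurable

/-! ### The bounded functional calculus of a resolution of the identity -/

/-- Polarization over `ℂ`: this is what allows operators to be specified by diagonal matrix elements
alone. -/
theorem ext_of_inner_self {U V : H →L[ℂ] H}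
    (h : ∀ x, ⟪x, U x⟫ = ⟪x, V x⟫) : U = V := by
  have h1 : (U : H →ₗ[ℂ] H) = V := (ext_inner_map _ _).1 fun x => by
    have := congrArg (starRingEnd ℂ) (h x)
    simpa using this
  ext x
  exact congrArg (fun T : H →ₗ[ℂ] H => T x) h1

theorem inner_apply_polarization (U : H →L[ℂ] H) (a b : H) :
    ⟪a, U b⟫ = 4⁻¹ * ⟪a + b, U (a + b)⟫ + -4⁻¹ * ⟪a - b, U (a - b)⟫
      + -(4⁻¹ * Complex.I) * ⟪a + Complex.I • b, U (a + Complex.I • b)⟫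
      + 4⁻¹ * Complex.I * ⟪a - Complex.I • b, U (a - Complex.I • b)⟫ := by
  simp only [map_add, map_sub, map_smul, inner_add_left, inner_add_right, inner_sub_left,
    inner_sub_right, inner_smul_left, inner_smul_right, Complex.conj_I]
  linear_combination ((1 / 2 : ℂ) * ⟪a, U b⟫ - (1 / 2 : ℂ) * ⟪b, U a⟫) * Complex.I_sq

namespace SpectralFamily

variable (E : SpectralFamily H)

theorem inner_proj_left (l : ℝ) (x y : H) : ⟪E.proj l x, y⟫ = ⟪x, E.proj l y⟫ := by
  have := (E.isStarProjection l).isSelfAdjoint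
  rw [ContinuousLinearMap.isSelfAdjoint_iff'] at this
  rw [← ContinuousLinearMap.adjoint_inner_left, this]

theorem proj_proj (k l : ℝ) (x : H) : E.proj k (E.proj l x) = E.proj (min k l) x := by
  rcases le_total k l with hkl | hkl
  · rw [min_eq_left hkl]
    exact congrArg (fun T : H →L[ℂ] H => T x) (E.mul_of_le k l hkl)
  · rw [min_eq_right hkl]
    have h := congrArg star (E.mul_of_le l k hkl)
    rw [star_mul, (E.isStarProjection l).isSelfAdjoint.star_eq,
      (E.isStarProjection k).isSelfAdjoint.star_eq] at h
    exact congrArg (fun T : H →L[ℂ] H => T x) h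

theorem stieltjes_apply (x : H) (l : ℝ) : E.stieltjes x l = (⟪x, E.proj l x⟫).re := rfl

theorem inner_proj_self (l : ℝ) (x : H) : ⟪x, E.proj l x⟫ = (E.stieltjes x l : ℂ) := by
  have h : ⟪x, E.proj l x⟫ = ⟪E.proj l x, E.proj l x⟫ := by
    rw [inner_proj_left, proj_proj, min_self]
  rw [stieltjes_apply, h, inner_self_eq_norm_sq_to_K]
  norm_cast

theorem tendsto_stieltjes_atBot (x : H) : Tendsto (E.stieltjes x) atBot (𝓝 0) := by
  have h : Continuous fun y : H => (⟪x, y⟫).re := by fun_prop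
  have h2 := (h.tendsto _).comp (E.tendsto_atBot x)
  rwa [inner_zero_right, Complex.zero_re] at h2

theorem tendsto_stieltjes_atTop (x : H) : Tendsto (E.stieltjes x) atTop (𝓝 (‖x‖ ^ 2)) := by
  have h : Continuous fun y : H => (⟪x, y⟫).re := by fun_prop
  have h2 := (h.tendsto _).comp (E.tendsto_atTop x)
  have h3 : (⟪x, x⟫).re = ‖x‖ ^ 2 := by
    rw [inner_self_eq_norm_sq_to_K]
    norm_cast
  rwa [h3] at h2

theorem measure_Iic (x : H) (l : ℝ) :
    E.measure x (Iic l) = ENNReal.ofReal (E.stieltjes x l) := by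
  rw [measure, StieltjesFunction.measure_Iic _ (E.tendsto_stieltjes_atBot x), sub_zero]

theorem measure_univ (x : H) : E.measure x univ = ENNReal.ofReal (‖x‖ ^ 2) := by
  rw [measure, StieltjesFunction.measure_univ _ (E.tendsto_stieltjes_atBot x)
    (E.tendsto_stieltjes_atTop x), sub_zero]

instance (x : H) : IsFiniteMeasure (E.measure x) :=
  ⟨by rw [measure_univ]; exact ENNReal.ofReal_lt_top⟩

theorem measureReal_univ (x : H) : (E.measure x).real univ = ‖x‖ ^ 2 := by
  rw [measureReal_def, measure_univ, ENNReal.toReal_ofReal (by positivity)]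

theorem measureReal_Iic (x : H) (l : ℝ) : (E.measure x).real (Iic l) = E.stieltjes x l := by
  rw [measureReal_def, measure_Iic, ENNReal.toReal_ofReal]
  rw [stieltjes_apply, inner_eq]
  positivity

theorem inner_proj_self_eq_measureReal (l : ℝ) (x : H) :
    ⟪x, E.proj l x⟫ = ((E.measure x).real (Iic l) : ℂ) := by
  rw [inner_proj_self, measureReal_Iic]

/-- `U` is the operator `∫ g dE`. -/
def Represents (g : ℝ → ℂ) (U : H →L[ℂ] H) : Prop :=
  ∀ x, ⟪x, U x⟫ = ∫ t, g t ∂(E.measure x)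

variable {E} {g h : ℝ → ℂ} {U V : H →L[ℂ] H}

theorem Represents.unique (hU : E.Represents g U) (hV : E.Represents g V) : U = V :=
  ext_of_inner_self fun x => (hU x).trans (hV x).symm

/-- Polarization expresses both `⟪a, U b⟫` and `⟪a, E.proj l b⟫` through four diagonal spectral
measures. Together with `-d` on the measure of `x` they form a relation between distribution
functions, which `sum_integral_mul_eq_zero` carries over to integrals of `g`. -/
theorem Represents.inner_eq_integral (hU : E.Represents g U) (hg : IsBddMeasurable g)
    {a b x : H} {d : ℝ → ℂ} (hd : Integrable d (E.measure x))
    (hab : ∀ l, ⟪a, E.proj l b⟫ = ∫ t in Iic l, d t ∂(E.measure x)) :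
    ⟪a, U b⟫ = ∫ t, g t * d t ∂(E.measure x) := by
  have key := sum_integral_mul_eq_zero
    (fun i => E.measure ((![a + b, a - b, a + Complex.I • b, a - Complex.I • b, x] : Fin 5 → H) i))
    (![fun _ => 4⁻¹, fun _ => -4⁻¹, fun _ => -(4⁻¹ * Complex.I), fun _ => 4⁻¹ * Complex.I,
      fun t => -d t] : Fin 5 → ℝ → ℂ)
    (by
      intro i
      fin_cases i
      · exact (IsBddMeasurable.const _).integrable _
      · exact (IsBddMeasurable.const _).integrable _
      · exact (IsBddMeasurable.const _).integrable _
      · exact (IsBddMeasurable.const _).integrable _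
      · exact hd.neg)
    (by
      intro l
      have e := hab l
      rw [inner_apply_polarization] at e
      simp only [inner_proj_self_eq_measureReal] at e
      simp [Fin.sum_univ_five, integral_neg, ← e]
      ring)
    g
    (by
      intro i
      fin_cases i
      · exact hg.integrable_mul ((IsBddMeasurable.const _).integrable _)
      · exact hg.integrable_mul ((IsBddMeasurable.const _).integrable _)
      · exact hg.integrable_mul ((IsBddMeasurable.const _).integrable _)
      · exact hg.integrable_mul ((IsBddMeasurable.const _).integrable _)
      · exact hg.integrable_mul hd.neg)
  simp only [Fin.sum_univ_five, Matrix.cons_val, mul_neg, integral_neg, integral_mul_const,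
    ← hU _] at key
  rw [inner_apply_polarization]
  linear_combination key

variable (E) in
theorem represents_proj (l : ℝ) : E.Represents ((Iic l).indicator fun _ => 1) (E.proj l) :=
  fun x => by
    rw [inner_proj_self_eq_measureReal, integral_indicator measurableSet_Iic]
    simp

theorem Represents.inner_proj (hU : E.Represents g U) (hg : IsBddMeasurable g) (l : ℝ) (x : H) :
    ⟪x, E.proj l (U x)⟫ = ∫ t in Iic l, g t ∂(E.measure x) := by
  rw [← inner_proj_left, hU.inner_eq_integral hg
    (((IsBddMeasurable.const 1).indicator (measurableSet_Iic (a := l))).integrable (E.measure x)),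
    ← integral_indicator measurableSet_Iic]
  · congr 1 with t
    by_cases ht : t ∈ Iic l <;> simp [ht]
  · intro k
    rw [inner_proj_left, proj_proj, inner_proj_self_eq_measureReal,
      setIntegral_indicator measurableSet_Iic, Iic_inter_Iic, min_comm]
    simp

/-- By `inner_proj` the complex measure `d⟪x, E_l V x⟫` has density `h` with respect to the spectral
measure of `x`; integrating `g` against it gives the product. -/
theorem Represents.mul (hU : E.Represents g U) (hg : IsBddMeasurable g)
    (hV : E.Represents h V) (hh : IsBddMeasurable h) :
    E.Represents (fun t => g t * h t) (U * V) := fun x =>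
  hU.inner_eq_integral hg (hh.integrable _) fun l => hV.inner_proj hh l x

theorem Represents.adjoint (hU : E.Represents g U) :
    E.Represents (fun t => (starRingEnd ℂ) (g t)) (ContinuousLinearMap.adjoint U) := fun x => by
  rw [ContinuousLinearMap.adjoint_inner_right, integral_conj, ← hU x, inner_conj_symm]

theorem Represents.add (hU : E.Represents g U) (hg : IsBddMeasurable g)
    (hV : E.Represents h V) (hh : IsBddMeasurable h) :
    E.Represents (fun t => g t + h t) (U + V) := fun x => by
  rw [integral_add (hg.integrable _) (hh.integrable _), ← hU x, ← hV x]
  simp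

theorem Represents.const_smul (hU : E.Represents g U) (c : ℂ) :
    E.Represents (fun t => c * g t) (c • U) := fun x => by
  rw [integral_const_mul, ← hU x]
  simp

theorem Represents.sub (hU : E.Represents g U) (hg : IsBddMeasurable g)
    (hV : E.Represents h V) (hh : IsBddMeasurable h) :
    E.Represents (fun t => g t - h t) (U - V) := fun x => by
  rw [integral_sub (hg.integrable _) (hh.integrable _), ← hU x, ← hV x]
  simp

variable (E) in
theorem represents_const (c : ℂ) : E.Represents (fun _ => c) (c • 1) := fun x => by
  simp [measureReal_univ, inner_self_eq_norm_sq_to_K, mul_comm]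

theorem Represents.norm_sq (hU : E.Represents g U) (hg : IsBddMeasurable g) (x : H) :
    ‖U x‖ ^ 2 = ∫ t, ‖g t‖ ^ 2 ∂(E.measure x) := by
  have h1 := (hU.adjoint.mul hg.conj hU hg) x
  rw [mul_apply_eq_comp, ContinuousLinearMap.adjoint_inner_right,
    inner_self_eq_norm_sq_to_K] at h1
  simp only [Complex.conj_mul'] at h1
  have h2 : ∫ t, (‖g t‖ : ℂ) ^ 2 ∂(E.measure x) = ((∫ t, ‖g t‖ ^ 2 ∂(E.measure x) : ℝ) : ℂ) := by
    rw [← integral_complex_ofReal]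
    push_cast
    rfl
  rw [h2] at h1
  exact Complex.ofReal_injective (by rw [← h1]; push_cast; rfl)

/-- Dominated pointwise limits of represented functions give strong limits. -/
theorem exists_tendsto_apply {G : ℕ → ℝ → ℂ} {W : ℕ → H →L[ℂ] H}
    (hW : ∀ n, E.Represents (G n) (W n)) (hG : ∀ n, IsBddMeasurable (G n)) (x : H) (b : ℝ → ℝ)
    (hb : Integrable (fun t => b t ^ 2) (E.measure x)) (hC : ∀ n t, ‖G n t‖ ≤ b t)
    (hlim : ∀ t, Tendsto (fun n => G n t) atTop (𝓝 (g t))) :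
    ∃ y, Tendsto (fun n => W n x) atTop (𝓝 y) := by
  refine cauchySeq_tendsto_of_complete ?_
  -- By `norm_sq` the Cauchy property is convergence in `L²` of the spectral measure. The bound need
  -- only be square integrable for this one `x`, so unbounded limits `g` are admitted.
  have h1 : Tendsto (fun p : ℕ × ℕ => ∫ t, ‖G p.1 t - G p.2 t‖ ^ 2 ∂(E.measure x)) atTop
      (𝓝 (∫ _, ‖(0 : ℂ)‖ ^ 2 ∂(E.measure x))) := by
    refine tendsto_integral_filter_of_dominated_convergence (fun t => 4 * b t ^ 2)
      (Eventually.of_forall fun p => (((hG _).1.sub (hG _).1).norm.pow_const 2).aestronglyMeasurable)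
      (Eventually.of_forall fun p => ae_of_all _ fun t => ?_) (hb.const_mul 4)
      (ae_of_all _ fun t => ?_)
    · rw [Real.norm_of_nonneg (by positivity)]
      calc ‖G p.1 t - G p.2 t‖ ^ 2 ≤ (b t + b t) ^ 2 := by
            gcongr
            exact (norm_sub_le _ _).trans (add_le_add (hC _ _) (hC _ _))
        _ = 4 * b t ^ 2 := by ring
    · have h2 : Tendsto (fun p : ℕ × ℕ => G p.1 t - G p.2 t) atTop (𝓝 (g t - g t)) := by
        rw [← prod_atTop_atTop_eq]
        exact ((hlim t).comp tendsto_fst).sub ((hlim t).comp tendsto_snd)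
      rw [sub_self] at h2
      exact (h2.norm).pow 2
  have h2 : Tendsto (fun p : ℕ × ℕ => ‖W p.1 x - W p.2 x‖ ^ 2) atTop (𝓝 0) := by
    simp only [norm_zero, ne_eq, OfNat.ofNat_ne_zero, not_false_eq_true, zero_pow,
      integral_zero] at h1
    refine h1.congr fun p => ?_
    exact ((((hW p.1).sub (hG _) (hW p.2) (hG _)).norm_sq ((hG _).sub (hG _)) x)).symm
  rw [cauchySeq_iff_tendsto_dist_atTop_0]
  have h3 := h2.sqrt
  simpa [dist_eq_norm, Real.sqrt_sq (norm_nonneg _)] using h3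

/-- Bounded pointwise limits of represented functions are represented, by strong limits. -/
theorem exists_represents_of_tendsto {G : ℕ → ℝ → ℂ} {W : ℕ → H →L[ℂ] H}
    (hW : ∀ n, E.Represents (G n) (W n)) (hG : ∀ n, Measurable (G n)) (C : ℝ)
    (hC : ∀ n t, ‖G n t‖ ≤ C) (hlim : ∀ t, Tendsto (fun n => G n t) atTop (𝓝 (g t))) :
    ∃ U : H →L[ℂ] H, E.Represents g U ∧ ∀ x, Tendsto (fun n => W n x) atTop (𝓝 (U x)) := by
  choose f hf using fun x => exists_tendsto_apply hW (fun n => ⟨hG n, C, hC n⟩) x (fun _ => C)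
    (integrable_const _) hC hlim
  refine ⟨continuousLinearMapOfTendsto W (tendsto_pi_nhds.2 hf), fun x => ?_, hf⟩
  have h1 : Tendsto (fun n => ⟪x, W n x⟫) atTop (𝓝 ⟪x, f x⟫) :=
    tendsto_const_nhds.inner (hf x)
  have h2 : Tendsto (fun n => ∫ t, G n t ∂(E.measure x)) atTop (𝓝 (∫ t, g t ∂(E.measure x))) :=
    tendsto_integral_of_dominated_convergence (fun _ => C)
      (fun n => (hG n).aestronglyMeasurable) (integrable_const _)
      (fun n => ae_of_all _ (hC n)) (ae_of_all _ hlim)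
  refine tendsto_nhds_unique h1 (h2.congr fun n => ?_)
  exact (hW n x).symm

variable (E)

/-- The sets having a spectral projection form a λ-system, countable disjoint unions being strong
limits of finite ones, and it contains the half-lines. -/
theorem exists_represents_indicator {s : Set ℝ} (hs : MeasurableSet s) :
    ∃ P : H →L[ℂ] H, E.Represents (s.indicator fun _ => 1) P := by
  induction s, hs using MeasurableSpace.induction_on_inter
    (borel_eq_generateFrom_Iic ℝ ▸ BorelSpace.measurable_eq (α := ℝ)) isPiSystem_Iic with
  | empty => exact ⟨0, fun x => by simp⟩
  | basic t ht =>
    obtain ⟨l, rfl⟩ := ht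
    exact ⟨_, E.represents_proj l⟩
  | compl t htm ih =>
    obtain ⟨P, hP⟩ := ih
    refine ⟨(1 : ℂ) • 1 - P, ?_⟩
    have h1 := (E.represents_const 1).sub (.const 1) hP ((IsBddMeasurable.const 1).indicator htm)
    convert h1 using 2 with t'
    by_cases ht : t' ∈ t <;> simp [ht]
  | iUnion F hd hm ih =>
    choose P hP using ih
    have hpart : ∀ n, E.Represents ((⋃ i ∈ Finset.range n, F i).indicator fun _ => 1)
        (∑ i ∈ Finset.range n, P i) := by
      intro n
      induction n with
      | zero => intro x; simp
      | succ n ihn =>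
        rw [Finset.sum_range_succ]
        have h1 := ihn.add ((IsBddMeasurable.const 1).indicator
          (Finset.measurableSet_biUnion _ fun i _ => hm i)) (hP n)
          ((IsBddMeasurable.const 1).indicator (hm n))
        convert h1 using 2 with t
        rw [Finset.range_add_one, Finset.set_biUnion_insert, union_comm,
          indicator_union_of_disjoint]
        rw [disjoint_iUnion₂_left]
        intro i hi
        exact hd (Finset.mem_range.1 hi).ne
    refine (exists_represents_of_tendsto hpart (fun n => measurable_const.indicator
      (Finset.measurableSet_biUnion _ fun i _ => hm i)) 1 (fun n t => ?_) fun t => ?_).imp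
      fun _ h => h.1
    · exact (norm_indicator_le_norm_self _ _).trans (by simp)
    · by_cases ht : ∃ i, t ∈ F i
      · obtain ⟨i, hi⟩ := ht
        have h1 : t ∈ ⋃ i, F i := mem_iUnion.2 ⟨i, hi⟩
        refine tendsto_const_nhds.congr' ?_
        filter_upwards [eventually_gt_atTop i] with n hn
        have h2 : t ∈ ⋃ i ∈ Finset.range n, F i := by
          simp only [mem_iUnion]
          exact ⟨i, Finset.mem_range.2 hn, hi⟩
        simp only [indicator_of_mem h1, indicator_of_mem h2]
      · have h1 : t ∉ ⋃ i, F i := by simpa using ht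
        have h2 : ∀ n, t ∉ ⋃ i ∈ Finset.range n, F i := fun n hn => by
          simp only [mem_iUnion] at hn
          obtain ⟨i, _, hi⟩ := hn
          exact ht ⟨i, hi⟩
        simp only [indicator_of_notMem h1, indicator_of_notMem (h2 _)]
        exact tendsto_const_nhds

/-- The bounded Borel functional calculus of a resolution of the identity. -/
theorem exists_represents (hg : IsBddMeasurable g) : ∃ U : H →L[ℂ] H, E.Represents g U := by
  have hsimple : ∀ f : SimpleFunc ℝ ℂ, ∃ U : H →L[ℂ] H, E.Represents f U := by
    intro f
    induction f using SimpleFunc.induction with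
    | @const c s hs =>
      obtain ⟨P, hP⟩ := E.exists_represents_indicator hs
      refine ⟨c • P, ?_⟩
      convert hP.const_smul c using 2 with t
      by_cases ht : t ∈ s <;> simp [ht, SimpleFunc.coe_piecewise, Set.piecewise, indicator]
    | @add f f' hd ihf ihf' =>
      obtain ⟨U, hU⟩ := ihf
      obtain ⟨V, hV⟩ := ihf'
      have hb : ∀ f : SimpleFunc ℝ ℂ, IsBddMeasurable f := fun f =>
        ⟨f.measurable, f.exists_forall_norm_le⟩
      exact ⟨U + V, hU.add (hb f) hV (hb f')⟩
  obtain ⟨mg, C, hC⟩ := hg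
  have hC0 : 0 ≤ C := (norm_nonneg _).trans (hC 0)
  choose W hW using fun n => hsimple (mg.stronglyMeasurable.approxBounded C n)
  exact (exists_represents_of_tendsto hW (fun n => SimpleFunc.measurable _) C
    (fun n t => mg.stronglyMeasurable.norm_approxBounded_le hC0 n t)
    (fun t => mg.stronglyMeasurable.tendsto_approxBounded_of_norm_le (hC t))).imp fun _ h => h.1

variable {E}

/-- For the spectral projection `P` of a set `s`, the operator `U† P U` represents `|g|²` restricted
to `s`. -/
theorem Represents.measure_apply (hU : E.Represents g U) (hg : IsBddMeasurable g) (x : H) :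
    E.measure (U x) = (E.measure x).withDensity fun t => ‖g t‖ₑ ^ 2 := by
  have hm : Measurable fun t => ‖g t‖ₑ ^ 2 := hg.1.enorm.pow_const 2
  refine Measure.ext fun s hs => ?_
  obtain ⟨P, hP⟩ := E.exists_represents_indicator hs
  have hPb : IsBddMeasurable (s.indicator fun _ => (1 : ℂ)) := (IsBddMeasurable.const 1).indicator hs
  have h1 := (hU.adjoint.mul hg.conj (hP.mul hPb hU hg) (hPb.mul hg)) x
  rw [mul_apply_eq_comp, ContinuousLinearMap.adjoint_inner_right,
    mul_apply_eq_comp, hP (U x), integral_indicator hs] at h1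
  simp only [setIntegral_const, mul_one, Complex.real_smul] at h1
  have h2 : ∀ t, (starRingEnd ℂ) (g t) * (s.indicator (fun _ => (1 : ℂ)) t * g t) =
      ((s.indicator (fun t => ‖g t‖ ^ 2) t : ℝ) : ℂ) := by
    intro t
    by_cases ht : t ∈ s <;> simp [ht, Complex.conj_mul']
  simp only [h2] at h1
  rw [integral_complex_ofReal, Complex.ofReal_inj, integral_indicator hs] at h1
  rw [withDensity_apply _ hs, ← ENNReal.ofReal_toReal (measure_ne_top (E.measure (U x)) s),
    ← measureReal_def, h1, ofReal_integral_eq_lintegral_ofReal]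
  · refine lintegral_congr fun t => ?_
    rw [ENNReal.ofReal_pow (norm_nonneg _), ofReal_norm]
  · obtain ⟨mg, C, hC⟩ := hg
    refine Integrable.of_bound (mg.norm.pow_const 2).aestronglyMeasurable (C ^ 2)
      (ae_of_all _ fun t => ?_)
    rw [Real.norm_of_nonneg (by positivity)]
    gcongr
    exact hC t
  · exact ae_of_all _ fun t => by positivity

end SpectralFamily

/-! ### Operators with a spectral resolution -/

/-- The function `t ↦ (t + i)⁻¹` on the real line. -/
def resolventFun : BoundedContinuousFunction ℝ ℂ :=
  BoundedContinuousFunction.ofNormedAddCommGroup (fun t : ℝ => ((t : ℂ) + Complex.I)⁻¹)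
    (by
      refine Continuous.inv₀ (by fun_prop) fun t h => ?_
      simpa using congrArg Complex.im h)
    1
    (by
      intro t
      rw [norm_inv]
      refine inv_le_one_of_one_le₀ ?_
      simpa using Complex.abs_im_le_norm ((t : ℂ) + Complex.I))

theorem resolventFun_apply (t : ℝ) : resolventFun t = ((t : ℂ) + Complex.I)⁻¹ := rfl

theorem ofReal_add_I_ne_zero (t : ℝ) : (t : ℂ) + Complex.I ≠ 0 := fun h => by
  simpa using congrArg Complex.im h

theorem _root_.BoundedContinuousFunction.isBddMeasurable (f : BoundedContinuousFunction ℝ ℂ) :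
    IsBddMeasurable f :=
  ⟨f.continuous.measurable, ‖f‖, f.norm_coe_le_norm⟩

theorem ofReal_mul_resolventFun (t : ℝ) :
    (t : ℂ) * resolventFun t = 1 - Complex.I * resolventFun t := by
  rw [resolventFun_apply]
  field_simp [ofReal_add_I_ne_zero t]
  ring

theorem isBddMeasurable_mul_resolventFun :
    IsBddMeasurable fun t : ℝ => (t : ℂ) * resolventFun t := by
  simp only [ofReal_mul_resolventFun]
  exact (IsBddMeasurable.const 1).sub ((IsBddMeasurable.const _).mul resolventFun.isBddMeasurable)

namespace SpectralFamily

variable {E F : SpectralFamily H} {T : H →ₗ.[ℂ] H} {g : ℝ → ℂ} {U V : H →L[ℂ] H}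

theorem Represents.integrable_iff (hU : E.Represents g U) (hg : IsBddMeasurable g) (x : H)
    (f : ℝ → ℝ) : Integrable f (E.measure (U x)) ↔
      Integrable (fun t => ‖g t‖ ^ 2 * f t) (E.measure x) := by
  rw [hU.measure_apply hg, integrable_withDensity_iff_integrable_smul' (hg.1.enorm.pow_const 2)
    (ae_of_all _ fun t => by simp)]
  simp

theorem Represents.integral_eq (hU : E.Represents g U) (hg : IsBddMeasurable g) (x : H)
    (f : ℝ → ℝ) : ∫ t, f t ∂(E.measure (U x)) = ∫ t, ‖g t‖ ^ 2 * f t ∂(E.measure x) := by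
  rw [hU.measure_apply hg, integral_withDensity_eq_integral_toReal_smul
    (hg.1.enorm.pow_const 2) (ae_of_all _ fun t => by simp)]
  simp

theorem Represents.eq_zero_of_apply_eq_zero (hU : E.Represents g U) (hg : IsBddMeasurable g)
    (h0 : ∀ t, g t ≠ 0) {x : H} (hx : U x = 0) : x = 0 := by
  have h1 := hU.norm_sq hg x
  rw [hx, norm_zero, zero_pow two_ne_zero, eq_comm, integral_eq_zero_iff_of_nonneg
    (fun t => by positivity)] at h1
  · have h2 : ∀ᵐ t ∂(E.measure x), False := h1.mono fun t ht => h0 t (by simpa using ht)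
    have h3 : E.measure x = 0 := by simpa using h2
    have h4 := E.measureReal_univ x
    rw [h3] at h4
    simpa using h4.symm
  · have := ((hg.mul hg.conj).integrable (E.measure x)).norm
    simpa [sq] using this

theorem IsResolutionOf.apply_mem_domain (hE : E.IsResolutionOf T) (hU : E.Represents g U)
    (hg : IsBddMeasurable g) (hg' : IsBddMeasurable fun t => (t : ℂ) * g t) (x : H) :
    U x ∈ T.domain := by
  rw [hE.1, hU.integrable_iff hg]
  have := ((hg'.mul hg'.conj).integrable (E.measure x)).norm
  refine this.congr (ae_of_all _ fun t => ?_)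
  simp only [norm_mul, RCLike.norm_conj, Complex.norm_real]
  rw [← sq_abs t, ← Real.norm_eq_abs]
  ring

/-- `IsResolutionOf` fixes only the quadratic form of `T`. The sandwich `U† T U` is defined
everywhere and has the same quadratic form as `U† V`, so the two agree by polarization, which needs
no boundedness. The function of `U†` has no zero, so `U†` is injective and cancels. -/
theorem IsResolutionOf.apply_resolvent (hE : E.IsResolutionOf T)
    (hU : E.Represents resolventFun U)
    (hV : E.Represents (fun t => (t : ℂ) * resolventFun t) V) (x : H) (hx : U x ∈ T.domain) :
    T ⟨U x, hx⟩ = V x := by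
  have hg := resolventFun.isBddMeasurable
  have hg' := isBddMeasurable_mul_resolventFun
  have hdom := hE.apply_mem_domain hU hg hg'
  let D : H →ₗ[ℂ] H := (ContinuousLinearMap.adjoint U : H →ₗ[ℂ] H) ∘ₗ T.toFun ∘ₗ
    (U : H →ₗ[ℂ] H).codRestrict T.domain hdom
  have hD : D = (ContinuousLinearMap.adjoint U * V : H →L[ℂ] H) := by
    refine (ext_inner_map _ _).1 fun y => ?_
    rw [← inner_conj_symm, ← inner_conj_symm (((ContinuousLinearMap.adjoint U * V : H →L[ℂ] H) :
      H →ₗ[ℂ] H) y)]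
    congr 1
    have h1 : ⟪y, D y⟫ = ⟪U y, T ⟨U y, hdom y⟩⟫ :=
      ContinuousLinearMap.adjoint_inner_right U y (T ⟨U y, hdom y⟩)
    have h2 := (hU.adjoint.mul hg.conj hV hg') y
    rw [h1, hE.2 ⟨U y, hdom y⟩, hU.integral_eq hg]
    refine Eq.trans ?_ h2.symm
    rw [← integral_complex_ofReal]
    refine integral_congr_ae (ae_of_all _ fun t => ?_)
    push_cast
    rw [← Complex.conj_mul']
    ring
  have h3 : ContinuousLinearMap.adjoint U (T ⟨U x, hx⟩ - V x) = 0 := by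
    rw [map_sub, sub_eq_zero]
    exact congrArg (fun S : H →ₗ[ℂ] H => S x) hD
  refine sub_eq_zero.1 (hU.adjoint.eq_zero_of_apply_eq_zero hg.conj (fun t => ?_) h3)
  rw [resolventFun_apply, Ne, map_eq_zero]
  exact inv_ne_zero (ofReal_add_I_ne_zero t)

theorem IsResolutionOf.apply_eq (hE : E.IsResolutionOf T) (hU : E.Represents g U)
    (hg : IsBddMeasurable g) (hV : E.Represents (fun t => (t : ℂ) * g t) V)
    (hg' : IsBddMeasurable fun t => (t : ℂ) * g t) (x : H) (hx : U x ∈ T.domain) :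
    T ⟨U x, hx⟩ = V x := by
  obtain ⟨R, hR⟩ := E.exists_represents resolventFun.isBddMeasurable
  obtain ⟨R', hR'⟩ := E.exists_represents isBddMeasurable_mul_resolventFun
  -- The function `(t + i) g` is bounded, so `U` and `V` factor through the resolvent and the
  -- special case applies.
  have hk : IsBddMeasurable fun t => (t : ℂ) * g t + Complex.I * g t :=
    hg'.add ((IsBddMeasurable.const _).mul hg)
  obtain ⟨K, hK⟩ := E.exists_represents hk
  have h1 : U = R * K := by
    refine hU.unique ?_
    convert hR.mul resolventFun.isBddMeasurable hK hk using 2 with t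
    rw [resolventFun_apply, ← add_mul, inv_mul_cancel_left₀ (ofReal_add_I_ne_zero t)]
  have h2 : V = R' * K := by
    refine hV.unique ?_
    convert hR'.mul isBddMeasurable_mul_resolventFun hK hk using 2 with t
    rw [resolventFun_apply, ← add_mul, mul_assoc,
      inv_mul_cancel_left₀ (ofReal_add_I_ne_zero t)]
  subst h1 h2
  exact hE.apply_resolvent hR hR' (K x) hx

/-- The quadratic form of `T` is real, so `-i` is not an eigenvalue; this makes `T + i` injective.
-/
theorem IsResolutionOf.eq_zero_of_apply_eq (hE : E.IsResolutionOf T) (x : T.domain)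
    (hx : T x = -Complex.I • (x : H)) : (x : H) = 0 := by
  have h1 := congrArg Complex.im (hE.2 x)
  rw [hx, inner_smul_right, inner_self_eq_norm_sq_to_K] at h1
  simp only [neg_mul, Complex.neg_im, ← Complex.ofReal_pow, Complex.coe_algebraMap,
    Complex.I_mul_im, Complex.ofReal_re, Complex.ofReal_im] at h1
  simpa using h1

theorem IsResolutionOf.resolvent_eq (hE : E.IsResolutionOf T) (hF : F.IsResolutionOf T)
    (hU : E.Represents resolventFun U) (hV : F.Represents resolventFun V) : U = V := by
  have key : ∀ (E' : SpectralFamily H) (W : H →L[ℂ] H), E'.IsResolutionOf T →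
      E'.Represents resolventFun W → ∀ x, ∃ h : W x ∈ T.domain,
      T ⟨W x, h⟩ = x - Complex.I • W x := by
    intro E' W hE' hW x
    have hb := resolventFun.isBddMeasurable
    refine ⟨hE'.apply_mem_domain hW hb isBddMeasurable_mul_resolventFun x, ?_⟩
    refine hE'.apply_resolvent (V := (1 : ℂ) • 1 - Complex.I • W) hW ?_ x _ |>.trans (by simp)
    simp only [ofReal_mul_resolventFun]
    exact (E'.represents_const 1).sub (.const 1) (hW.const_smul _)
      ((IsBddMeasurable.const _).mul hb)
  ext x
  obtain ⟨h1, e1⟩ := key E U hE hU x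
  obtain ⟨h2, e2⟩ := key F V hF hV x
  have h3 := hE.eq_zero_of_apply_eq (⟨U x, h1⟩ - ⟨V x, h2⟩) (by
    rw [LinearPMap.map_sub, e1, e2]
    simp only [AddSubgroupClass.coe_sub, neg_smul, smul_sub]
    abel)
  exact sub_eq_zero.1 h3

/-- The spectral resolution of an operator is unique. -/
theorem IsResolutionOf.unique (hE : E.IsResolutionOf T) (hF : F.IsResolutionOf T) : E = F := by
  obtain ⟨R, hR⟩ := E.exists_represents resolventFun.isBddMeasurable
  obtain ⟨R', hR'⟩ := F.exists_represents resolventFun.isBddMeasurable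
  obtain rfl := hE.resolvent_eq hF hR hR'
  -- Both resolutions assign the same operator to each function of the star algebra generated by the
  -- common resolvent. That algebra separates points, so it determines the finite measures.
  have hrep : ∀ f ∈ StarAlgebra.adjoin ℂ {resolventFun},
      ∃ U : H →L[ℂ] H, E.Represents f U ∧ F.Represents f U := by
    intro f hf
    induction hf using StarAlgebra.adjoin_induction with
    | mem f hf =>
      obtain rfl := hf
      exact ⟨R, hR, hR'⟩
    | algebraMap c => exact ⟨c • 1, E.represents_const c, F.represents_const c⟩
    | add f f' _ _ ih ih' =>
      obtain ⟨U, h1, h2⟩ := ih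
      obtain ⟨V, h3, h4⟩ := ih'
      exact ⟨U + V, h1.add f.isBddMeasurable h3 f'.isBddMeasurable,
        h2.add f.isBddMeasurable h4 f'.isBddMeasurable⟩
    | mul f f' _ _ ih ih' =>
      obtain ⟨U, h1, h2⟩ := ih
      obtain ⟨V, h3, h4⟩ := ih'
      exact ⟨U * V, h1.mul f.isBddMeasurable h3 f'.isBddMeasurable,
        h2.mul f.isBddMeasurable h4 f'.isBddMeasurable⟩
    | star f _ ih =>
      obtain ⟨U, h1, h2⟩ := ih
      exact ⟨_, h1.adjoint, h2.adjoint⟩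
  have hmeas : ∀ x, E.measure x = F.measure x := by
    intro x
    refine ext_of_forall_mem_subalgebra_integral_eq_of_polish (𝕜 := ℂ)
      (A := StarAlgebra.adjoin ℂ {resolventFun}) ?_ fun f hf => ?_
    · intro s t hst
      refine ⟨resolventFun, ⟨BoundedContinuousFunction.toContinuousMapStarₐ ℂ resolventFun,
        ⟨resolventFun, StarAlgebra.subset_adjoin ℂ _ rfl, rfl⟩, rfl⟩, fun h => hst ?_⟩
      rw [resolventFun_apply, resolventFun_apply] at h
      simpa using h
    · obtain ⟨U, h1, h2⟩ := hrep f hf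
      rw [← h1 x, ← h2 x]
  refine SpectralFamily.ext (funext fun l => ext_of_inner_self fun x => ?_)
  rw [inner_proj_self_eq_measureReal, inner_proj_self_eq_measureReal, hmeas]

/-- The spectral resolution of a strictly positive operator is concentrated on `(0, ∞)`. -/
theorem IsResolutionOf.measure_Iic_zero (hE : E.IsResolutionOf T)
    (hT : ∀ x : T.domain, (x : H) ≠ 0 → 0 < (⟪(x : H), T x⟫).re) (x : H) :
    E.measure x (Iic 0) = 0 := by
  -- On a bounded interval the range of the spectral projection lies in the domain of `T`, where the
  -- form would be nonpositive; strict positivity leaves only the zero vector.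
  have hU : Iic (0 : ℝ) = ⋃ n : ℕ, Ioc (-(n : ℝ)) 0 := by
    ext t
    simp only [mem_Iic, mem_iUnion, mem_Ioc, exists_and_right]
    obtain ⟨n, hn⟩ := exists_nat_gt (-t)
    exact ⟨fun h => ⟨⟨n, by linarith⟩, h⟩, fun h => h.2⟩
  rw [hU, measure_iUnion_null_iff]
  intro n
  have hs : MeasurableSet (Ioc (-(n : ℝ)) 0) := measurableSet_Ioc
  obtain ⟨P, hP⟩ := E.exists_represents_indicator hs
  have hb : IsBddMeasurable ((Ioc (-(n : ℝ)) 0).indicator fun _ => (1 : ℂ)) :=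
    (IsBddMeasurable.const 1).indicator hs
  have hb' : IsBddMeasurable
      fun t => (t : ℂ) * (Ioc (-(n : ℝ)) 0).indicator (fun _ => (1 : ℂ)) t := by
    refine ⟨Complex.measurable_ofReal.mul hb.1, n, fun t => ?_⟩
    by_cases ht : t ∈ Ioc (-(n : ℝ)) 0
    · simp only [ht, indicator_of_mem, mul_one, Complex.norm_real, Real.norm_eq_abs, abs_le]
      exact ⟨ht.1.le, ht.2.trans (Nat.cast_nonneg n)⟩
    · simp [ht]
  have hnsq : ∀ t, ‖(Ioc (-(n : ℝ)) 0).indicator (fun _ => (1 : ℂ)) t‖ ^ 2 =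
      (Ioc (-(n : ℝ)) 0).indicator (fun _ => (1 : ℝ)) t := fun t => by
    by_cases ht : t ∈ Ioc (-(n : ℝ)) 0 <;> simp [ht]
  have hdom := hE.apply_mem_domain hP hb hb' x
  have h0 : P x = 0 := by
    by_contra hne
    have h1 := hT ⟨P x, hdom⟩ hne
    rw [hE.2 ⟨P x, hdom⟩, Complex.ofReal_re, hP.integral_eq hb] at h1
    refine h1.not_ge (integral_nonpos fun t => ?_)
    simp only [hnsq]
    by_cases ht : t ∈ Ioc (-(n : ℝ)) 0
    · simpa [ht] using ht.2
    · simp [ht]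
  have h2 := hP.norm_sq hb x
  simp only [hnsq] at h2
  rw [h0, norm_zero, zero_pow two_ne_zero, integral_indicator hs] at h2
  simp only [setIntegral_const, smul_eq_mul, mul_one] at h2
  exact (measureReal_eq_zero_iff).1 h2.symm

end SpectralFamily

/-! ### Spectral measures of bounded self-adjoint operators -/

section BoundedOperator

open scoped CompactlySupported

variable {R : H →L[ℂ] H} (hR : IsSelfAdjoint R)

/-- The positive functional `f ↦ ⟨x, f(R) x⟩` of a vector `x`. -/
def vectorFunctional (x : H) : C_c(spectrum ℝ R, ℝ) →ₚ[ℝ] ℝ :=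
  PositiveLinearMap.mk₀
    { toFun := fun f => (⟪x, cfcHom hR f.toContinuousMap x⟫).re
      map_add' := fun f g => by
        rw [show (f + g).toContinuousMap = f.toContinuousMap + g.toContinuousMap from rfl]
        simp
      map_smul' := fun c f => by
        rw [show (c • f).toContinuousMap = c • f.toContinuousMap from rfl]
        simp }
    (fun f hf => by
      have h1 : 0 ≤ cfcHom hR f.toContinuousMap := (cfcHom_nonneg_iff hR).2 hf
      rw [ContinuousLinearMap.nonneg_iff_isPositive] at h1
      simpa using h1.re_inner_nonneg_right x)

/-- The spectral measure of a vector `x`, on the spectrum of `R`. -/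
def vectorMeasure (x : H) : Measure (spectrum ℝ R) :=
  RealRMK.rieszMeasure (vectorFunctional hR x)

instance (x : H) : IsFiniteMeasure (vectorMeasure hR x) :=
  inferInstanceAs (IsFiniteMeasure (RealRMK.rieszMeasure _))

/-- The Riesz functional records only the real part; nothing is lost because `f(R)` is self-adjoint.
-/
theorem inner_cfcHom (f : C(spectrum ℝ R, ℝ)) (x : H) :
    ⟪x, cfcHom hR f x⟫ = ((∫ t, f t ∂(vectorMeasure hR x) : ℝ) : ℂ) := by
  have h1 := RealRMK.integral_rieszMeasure (vectorFunctional hR x)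
    (CompactlySupportedContinuousMap.continuousMapEquiv f)
  have h2 : IsSelfAdjoint (cfcHom hR f) := by
    rw [isSelfAdjoint_iff, ← map_star, star_trivial]
  have h3 : ∫ t, f t ∂(vectorMeasure hR x) = (⟪x, cfcHom hR f x⟫).re := h1
  rw [h3, eq_comm, ← Complex.conj_eq_iff_re, inner_conj_symm]
  rw [ContinuousLinearMap.isSelfAdjoint_iff'] at h2
  conv_rhs => rw [← h2, ContinuousLinearMap.adjoint_inner_right]

theorem norm_sq_cfcHom (f : C(spectrum ℝ R, ℝ)) (x : H) :
    ‖cfcHom hR f x‖ ^ 2 = ∫ t, f t ^ 2 ∂(vectorMeasure hR x) := by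
  have h2 : IsSelfAdjoint (cfcHom hR f) := by
    rw [isSelfAdjoint_iff, ← map_star, star_trivial]
  rw [ContinuousLinearMap.isSelfAdjoint_iff'] at h2
  have h1 := inner_cfcHom hR (f * f) x
  rw [map_mul, mul_apply_eq_comp, ← ContinuousLinearMap.adjoint_inner_left, h2,
    inner_self_eq_norm_sq_to_K] at h1
  have h3 : ((‖cfcHom hR f x‖ ^ 2 : ℝ) : ℂ) =
      ((∫ t, (f * f) t ∂(vectorMeasure hR x) : ℝ) : ℂ) := by
    rw [← h1]
    push_cast
    rfl
  rw [Complex.ofReal_injective h3]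
  simp only [ContinuousMap.mul_apply, sq]

theorem vectorMeasure_real_univ (x : H) : (vectorMeasure hR x).real univ = ‖x‖ ^ 2 := by
  have h1 := norm_sq_cfcHom hR 1 x
  simpa using h1.symm

theorem norm_cfcHom_apply_le {f : C(spectrum ℝ R, ℝ)} (hf : ∀ t, f t ∈ Icc (0 : ℝ) 1) (x : H) :
    ‖cfcHom hR f x‖ ≤ ‖x‖ := by
  rw [← sq_le_sq₀ (norm_nonneg _) (norm_nonneg _), norm_sq_cfcHom, ← vectorMeasure_real_univ hR]
  calc ∫ t, f t ^ 2 ∂(vectorMeasure hR x) ≤ ∫ _, 1 ∂(vectorMeasure hR x) := by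
        refine integral_mono_of_nonneg (ae_of_all _ fun t => by positivity) (integrable_const _)
          (ae_of_all _ fun t => ?_)
        exact pow_le_one₀ (hf t).1 (hf t).2
    _ = (vectorMeasure hR x).real univ := by simp

theorem tendsto_pow_of_mem_Icc {a : ℝ} (ha : a ∈ Icc (0 : ℝ) 1) :
    Tendsto (fun n : ℕ => a ^ n) atTop (𝓝 (({1} : Set ℝ).indicator (fun _ => 1) a)) := by
  rcases eq_or_lt_of_le ha.2 with h | h
  · simp [h]
  · rw [indicator_of_notMem (by simpa using h.ne)]
    exact tendsto_pow_atTop_nhds_zero_of_lt_one ha.1 h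

/-- For a continuous function `f` with values in `[0, 1]` the powers of `f(R)` converge strongly
to the spectral projection of the set `{f = 1}`. -/
theorem exists_tendsto_pow {f : C(spectrum ℝ R, ℝ)} (hf : ∀ t, f t ∈ Icc (0 : ℝ) 1) :
    ∃ P : H →L[ℂ] H, (∀ x, Tendsto (fun n => cfcHom hR (f ^ n) x) atTop (𝓝 (P x))) ∧
      ∀ x, ⟪x, P x⟫ = ((vectorMeasure hR x).real {t | f t = 1} : ℂ) := by
  have hfn : ∀ n t, f t ^ n ∈ Icc (0 : ℝ) 1 := fun n t =>
    ⟨pow_nonneg (hf t).1 n, pow_le_one₀ (hf t).1 (hf t).2⟩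
  have hcau : ∀ x, CauchySeq fun n => cfcHom hR (f ^ n) x := by
    intro x
    have h1 : Tendsto (fun p : ℕ × ℕ => ∫ t, (f t ^ p.1 - f t ^ p.2) ^ 2 ∂(vectorMeasure hR x))
        atTop (𝓝 (∫ _, (0 : ℝ) ^ 2 ∂(vectorMeasure hR x))) := by
      refine tendsto_integral_filter_of_dominated_convergence (fun _ => 1)
        (Eventually.of_forall fun p => by fun_prop)
        (Eventually.of_forall fun p => ae_of_all _ fun t => ?_) (integrable_const _)
        (ae_of_all _ fun t => ?_)
      · rw [Real.norm_of_nonneg (by positivity), sq_le_one_iff_abs_le_one, abs_le]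
        have h1 := hfn p.1 t
        have h2 := hfn p.2 t
        exact ⟨by linarith [h1.1, h2.2], by linarith [h1.2, h2.1]⟩
      · refine Tendsto.pow ?_ 2
        have h2 := tendsto_pow_of_mem_Icc (hf t)
        rw [← prod_atTop_atTop_eq]
        simpa using (h2.comp tendsto_fst).sub (h2.comp tendsto_snd)
    have h2 : Tendsto (fun p : ℕ × ℕ => ‖cfcHom hR (f ^ p.1) x - cfcHom hR (f ^ p.2) x‖ ^ 2)
        atTop (𝓝 0) := by
      simp only [ne_eq, OfNat.ofNat_ne_zero, not_false_eq_true, zero_pow, integral_zero] at h1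
      refine h1.congr fun p => ?_
      have h3 := norm_sq_cfcHom hR (f ^ p.1 - f ^ p.2) x
      rw [map_sub, sub_apply] at h3
      rw [h3]
      rfl
    rw [cauchySeq_iff_tendsto_dist_atTop_0]
    have h3 := h2.sqrt
    simpa [dist_eq_norm, Real.sqrt_sq (norm_nonneg _)] using h3
  choose p hp using fun x => cauchySeq_tendsto_of_complete (hcau x)
  refine ⟨continuousLinearMapOfTendsto _ (tendsto_pi_nhds.2 hp), hp, fun x => ?_⟩
  have h1 : Tendsto (fun n => ⟪x, cfcHom hR (f ^ n) x⟫) atTop (𝓝 ⟪x, p x⟫) :=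
    tendsto_const_nhds.inner (hp x)
  have h2 : Tendsto (fun n => ∫ t, f t ^ n ∂(vectorMeasure hR x)) atTop
      (𝓝 (∫ t, ({1} : Set ℝ).indicator (fun _ => 1) (f t) ∂(vectorMeasure hR x))) :=
    tendsto_integral_of_dominated_convergence (fun _ => 1)
      (fun n => by fun_prop) (integrable_const _)
      (fun n => ae_of_all _ fun t => by
        rw [Real.norm_of_nonneg (hfn n t).1]
        exact (hfn n t).2)
      (ae_of_all _ fun t => tendsto_pow_of_mem_Icc (hf t))
  have h3 : ∫ t, ({1} : Set ℝ).indicator (fun _ => 1) (f t) ∂(vectorMeasure hR x) =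
      (vectorMeasure hR x).real {t | f t = 1} := by
    have h4 : MeasurableSet {t | f t = 1} :=
      (isClosed_eq f.continuous continuous_const).measurableSet
    rw [← integral_indicator_one h4]
    rfl
  rw [h3] at h2
  refine tendsto_nhds_unique h1 ?_
  refine ((Complex.continuous_ofReal.tendsto _).comp h2).congr fun n => ?_
  exact (inner_cfcHom hR (f ^ n) x).symm

theorem spectrum_subset_Icc (hR0 : 0 ≤ R) (hR1 : ‖R‖ ≤ 1) : spectrum ℝ R ⊆ Icc 0 1 := fun t ht =>
  ⟨spectrum_nonneg_of_nonneg hR0 ht, (le_abs_self t).trans <| by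
    have h1 := spectrum.norm_le_norm_mul_of_mem ht
    have h2 : ‖(1 : H →L[ℂ] H)‖ ≤ 1 := ContinuousLinearMap.norm_id_le
    rw [Real.norm_eq_abs] at h1
    nlinarith [norm_nonneg R]⟩

/-- The spectral projection `P` of `{0}` is the strong limit of `(1 - R) ^ n`. Since `t (1 - t) ^ n
→ 0` on `[0, 1]`, it satisfies `R P = 0`, and injectivity of `R` gives `P = 0`. -/
theorem vectorMeasure_zero_eq_zero (hR0 : 0 ≤ R) (hR1 : ‖R‖ ≤ 1) (hinj : ∀ x, R x = 0 → x = 0)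
    (x : H) : (vectorMeasure hR x).real {t | (t : ℝ) = 0} = 0 := by
  have hmem := spectrum_subset_Icc hR0 hR1
  let j : C(spectrum ℝ R, ℝ) := ⟨fun t => t, by fun_prop⟩
  have hj : cfcHom hR j = R := cfcHom_id hR
  have hf : ∀ t, (1 - j) t ∈ Icc (0 : ℝ) 1 := fun t => by
    have := hmem t.2
    exact ⟨sub_nonneg.2 this.2, sub_le_self _ this.1⟩
  obtain ⟨P, hP, hPm⟩ := exists_tendsto_pow hR hf
  have h1 : Tendsto (fun n => ‖R (cfcHom hR ((1 - j) ^ n) x)‖ ^ 2) atTop (𝓝 0) := by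
    have h2 : Tendsto (fun n => ∫ t, (j t * (1 - j) t ^ n) ^ 2 ∂(vectorMeasure hR x)) atTop
        (𝓝 (∫ _, (0 : ℝ) ^ 2 ∂(vectorMeasure hR x))) := by
      refine tendsto_integral_of_dominated_convergence (fun _ => 1) (fun n => by fun_prop)
        (integrable_const _) (fun n => ae_of_all _ fun t => ?_) (ae_of_all _ fun t => ?_)
      · rw [Real.norm_of_nonneg (by positivity)]
        have h3 := hmem t.2
        have h4 : (1 - j) t ^ n ≤ 1 := pow_le_one₀ (hf t).1 (hf t).2
        exact pow_le_one₀ (mul_nonneg h3.1 (pow_nonneg (hf t).1 n))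
          (mul_le_one₀ h3.2 (pow_nonneg (hf t).1 n) h4)
      · refine Tendsto.pow ?_ 2
        have h3 := (tendsto_pow_of_mem_Icc (hf t)).const_mul (j t)
        convert h3 using 2
        by_cases h4 : (1 - j) t = 1
        · have h5 : j t = 0 := by
            have : 1 - j t = 1 := h4
            linarith
          simp [h5]
        · rw [indicator_of_notMem (by simpa using h4)]
          simp
    simp only [ne_eq, OfNat.ofNat_ne_zero, not_false_eq_true, zero_pow, integral_zero] at h2
    refine h2.congr fun n => ?_
    have h3 := norm_sq_cfcHom hR (j * (1 - j) ^ n) x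
    rw [map_mul, hj, mul_apply_eq_comp] at h3
    rw [h3]
    rfl
  have h2 : Tendsto (fun n => ‖R (cfcHom hR ((1 - j) ^ n) x)‖ ^ 2) atTop (𝓝 (‖R (P x)‖ ^ 2)) :=
    (((R.continuous.tendsto _).comp (hP x)).norm).pow 2
  have h3 : P x = 0 := hinj _ (by simpa using tendsto_nhds_unique h2 h1)
  have h4 := hPm x
  rw [h3, inner_zero_right, eq_comm, Complex.ofReal_eq_zero] at h4
  refine Eq.trans ?_ h4
  refine congrArg (vectorMeasure hR x).real (Set.ext fun t => ?_)
  change (t : ℝ) = 0 ↔ 1 - (t : ℝ) = 1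
  constructor <;> intro h <;> linarith

end BoundedOperator

/-! ### Construction of resolutions of the identity -/

/-- A family of spectral projections given by finite measures on the real line. -/
theorem SpectralFamily.exists_of_measure (P : ℝ → H →L[ℂ] H) (m : H → Measure ℝ)
    [∀ x, IsFiniteMeasure (m x)] (hP : ∀ l, IsStarProjection (P l))
    (hmul : ∀ k l, k ≤ l → P k * P l = P k)
    (hm : ∀ x l, ⟪x, P l x⟫ = ((m x).real (Iic l) : ℂ)) (hu : ∀ x, (m x).real univ = ‖x‖ ^ 2) :
    ∃ E : SpectralFamily H, ∀ x, E.measure x = m x := by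
  have hself : ∀ l x y, ⟪P l x, y⟫ = ⟪x, P l y⟫ := fun l x y => by
    have := (hP l).isSelfAdjoint
    rw [ContinuousLinearMap.isSelfAdjoint_iff'] at this
    rw [← ContinuousLinearMap.adjoint_inner_left, this]
  have hidem : ∀ l x, P l (P l x) = P l x := fun l x =>
    congrArg (fun T : H →L[ℂ] H => T x) (hmul l l le_rfl)
  -- The distribution function is the squared norm of the projection. With Pythagoras this turns
  -- continuity of the measure along half-lines into strong convergence of the projections.
  have hnorm : ∀ l x, ‖P l x‖ ^ 2 = (m x).real (Iic l) := fun l x => by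
    have h1 := hm x l
    rw [← hidem, ← hself, inner_self_eq_norm_sq_to_K] at h1
    exact Complex.ofReal_injective (by rw [← h1]; push_cast; rfl)
  have hsub : ∀ l x, ‖x - P l x‖ ^ 2 = ‖x‖ ^ 2 - ‖P l x‖ ^ 2 := fun l x => by
    have h1 := @norm_sub_sq ℂ H _ _ _ x (P l x)
    rw [hm x l, ← hnorm] at h1
    rw [h1, RCLike.re_eq_complex_re, Complex.ofReal_re]
    ring
  have hsub' : ∀ k l x, k ≤ l → ‖P l x - P k x‖ ^ 2 = ‖P l x‖ ^ 2 - ‖P k x‖ ^ 2 :=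
    fun k l x hkl => by
    have h1 := hsub k (P l x)
    have h2 : P k (P l x) = P k x := congrArg (fun T : H →L[ℂ] H => T x) (hmul k l hkl)
    rwa [h2] at h1
  have htend : ∀ {L : Filter ℝ} {u : ℝ → H}, Tendsto (fun l => ‖u l‖ ^ 2) L (𝓝 0) →
      Tendsto u L (𝓝 0) := fun {L u} h => by
    rw [tendsto_zero_iff_norm_tendsto_zero]
    simpa [Real.sqrt_sq (norm_nonneg _)] using h.sqrt
  let E : SpectralFamily H :=
    { proj := P
      isStarProjection := hP
      mul_of_le := hmul
      right_cont := fun l x => by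
        have h1 := tendsto_measure_biInter_gt (μ := m x) (s := Iic) (a := l)
          (fun _ _ => measurableSet_Iic.nullMeasurableSet) (fun _ _ _ h => Iic_subset_Iic.2 h)
          ⟨l + 1, by simp, measure_ne_top _ _⟩
        have h2 : (⋂ r, ⋂ (_ : r > l), Iic r) = Iic l := by
          ext t
          simp only [mem_iInter, mem_Iic]
          exact ⟨fun h => le_of_forall_gt_imp_ge_of_dense h, fun h r hr => h.trans hr.le⟩
        rw [h2] at h1
        have h3 : Tendsto (fun k => ‖P k x‖ ^ 2) (𝓝[>] l) (𝓝 (‖P l x‖ ^ 2)) := by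
          simp only [hnorm]
          exact (ENNReal.tendsto_toReal (measure_ne_top _ _)).comp h1
        refine tendsto_sub_nhds_zero_iff.1 (htend ?_)
        have h4 := h3.sub_const (‖P l x‖ ^ 2)
        rw [sub_self] at h4
        refine h4.congr' ?_
        filter_upwards [self_mem_nhdsWithin] with k hk
        exact (hsub' l k x (le_of_lt hk)).symm
      tendsto_atBot := fun x => by
        have h1 := tendsto_measure_iInter_atBot (μ := m x) (s := Iic)
          (fun _ => measurableSet_Iic.nullMeasurableSet) (fun _ _ h => Iic_subset_Iic.2 h)
          ⟨0, measure_ne_top _ _⟩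
        rw [iInter_Iic_eq_empty_iff.2 (by simp), measure_empty] at h1
        refine htend ?_
        simp only [hnorm]
        exact (ENNReal.tendsto_toReal ENNReal.zero_ne_top).comp h1
      tendsto_atTop := fun x => by
        have h1 := tendsto_measure_Iic_atTop (m x)
        have h3 : Tendsto (fun k => ‖P k x‖ ^ 2) atTop (𝓝 (‖x‖ ^ 2)) := by
          simp only [hnorm, ← hu]
          exact (ENNReal.tendsto_toReal (measure_ne_top _ _)).comp h1
        have h4 := h3.const_sub (‖x‖ ^ 2)
        simp only [sub_self, ← hsub] at h4
        have h5 := htend h4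
        simpa using (tendsto_const_nhds (x := x)).sub h5 }
  refine ⟨E, fun x => Measure.ext_of_Iic _ _ fun l => ?_⟩
  rw [← measureReal_eq_measureReal_iff]
  have h1 := E.inner_proj_self_eq_measureReal l x
  exact Complex.ofReal_injective (h1.symm.trans (hm x l))

/-- An injective positive contraction is `∫ (1 + |t|)⁻¹ dE` for a resolution of the identity `E`
concentrated on the half-line. -/
theorem exists_spectralFamily {R : H →L[ℂ] H} (hR0 : 0 ≤ R) (hR1 : ‖R‖ ≤ 1)
    (hinj : ∀ x, R x = 0 → x = 0) :
    ∃ E : SpectralFamily H, (∀ x, E.measure x (Iio 0) = 0) ∧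
      E.Represents (fun t => ((1 + |t|)⁻¹ : ℝ)) R := by
  have hR : IsSelfAdjoint R := IsSelfAdjoint.of_nonneg hR0
  have hmem := spectrum_subset_Icc hR0 hR1
  -- For `t > 0` the value `1` is attained exactly when `t⁻¹ - 1 ≤ l`, so the limit of the powers of
  -- `q l` is the projection of `R⁻¹ - 1` for `(-∞, l]`.
  let q : ℝ → C(spectrum ℝ R, ℝ) := fun l => ⟨fun t => max 0 (min 1 ((1 + l) * t)), by fun_prop⟩
  have hq : ∀ l t, q l t ∈ Icc (0 : ℝ) 1 := fun l t =>
    ⟨le_max_left _ _, max_le zero_le_one (min_le_left _ _)⟩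
  have hq1 : ∀ l t, q l t = 1 ↔ 1 ≤ (1 + l) * (t : ℝ) := fun l t => by
    change max 0 (min 1 ((1 + l) * (t : ℝ))) = 1 ↔ _
    constructor
    · intro h
      by_contra hlt
      rw [min_eq_right (not_le.1 hlt).le] at h
      rcases max_choice 0 ((1 + l) * (t : ℝ)) with h' | h' <;> linarith
    · intro h
      rw [min_eq_left h]
      exact max_eq_right zero_le_one
  choose P hP hPm using fun l => exists_tendsto_pow hR (hq l)
  have hsa : ∀ l, IsSelfAdjoint (P l) := fun l => by
    rw [ContinuousLinearMap.isSelfAdjoint_iff']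
    refine ext_of_inner_self fun x => ?_
    rw [ContinuousLinearMap.adjoint_inner_right, ← inner_conj_symm, hPm, Complex.conj_ofReal]
  have hmul : ∀ k l, k ≤ l → P k * P l = P k := by
    intro k l hkl
    have hkl1 : ∀ t, (q k * q l) t ∈ Icc (0 : ℝ) 1 := fun t =>
      ⟨mul_nonneg (hq k t).1 (hq l t).1, mul_le_one₀ (hq k t).2 (hq l t).1 (hq l t).2⟩
    obtain ⟨Q, hQ, hQm⟩ := exists_tendsto_pow hR hkl1
    -- The sets `{q k = 1}` and `{q l = 1}` are nested for `k ≤ l`, so the product equals `1`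
    -- exactly where `q k` does.
    have h1 : Q = P k := ext_of_inner_self fun x => by
      rw [hQm, hPm]
      congr 2
      ext t
      simp only [mem_ofPred_eq, ContinuousMap.mul_apply]
      constructor
      · intro h
        nlinarith [(hq k t).1, (hq k t).2, (hq l t).1, (hq l t).2]
      · intro h
        have h2 : q l t = 1 := (hq1 l t).2 (((hq1 k t).1 h).trans
          (mul_le_mul_of_nonneg_right (by linarith) (hmem t.2).1))
        rw [h, h2, one_mul]
    rw [← h1]
    ext x
    refine tendsto_nhds_unique ?_ (hQ x)
    have h2 : Tendsto (fun n => cfcHom hR (q k ^ n) (P l x)) atTop (𝓝 (P k (P l x))) := hP k _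
    -- The powers are contractions, so the inner limit may be taken first.
    have h3 : Tendsto (fun n => cfcHom hR (q k ^ n) (cfcHom hR (q l ^ n) x - P l x)) atTop
        (𝓝 0) := by
      refine squeeze_zero_norm (a := fun n => ‖cfcHom hR (q l ^ n) x - P l x‖) (fun n => ?_) ?_
      · refine norm_cfcHom_apply_le hR (fun t => ?_) _
        exact ⟨pow_nonneg (hq k t).1 n, pow_le_one₀ (hq k t).1 (hq k t).2⟩
      · simpa using ((hP l x).sub_const (P l x)).norm
    have h4 := h3.add h2
    rw [zero_add] at h4
    subst h1
    refine h4.congr fun n => ?_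
    rw [← map_add, sub_add_cancel, ← mul_apply_eq_comp, ← map_mul, mul_pow]
  have hφ : Measurable fun t : spectrum ℝ R => (t : ℝ)⁻¹ - 1 :=
    (measurable_subtype_coe.inv).sub_const 1
  have hnull : ∀ x, ∀ᵐ t : spectrum ℝ R ∂(vectorMeasure hR x), (0 : ℝ) < (t : ℝ) := fun x => by
    have h1 := vectorMeasure_zero_eq_zero hR hR0 hR1 hinj x
    rw [measureReal_eq_zero_iff] at h1
    refine (measure_eq_zero_iff_ae_notMem.1 h1).mono fun t ht => ?_
    exact lt_of_le_of_ne (hmem t.2).1 (Ne.symm ht)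
  obtain ⟨E, hE⟩ := SpectralFamily.exists_of_measure P
    (fun x => (vectorMeasure hR x).map fun t : spectrum ℝ R => (t : ℝ)⁻¹ - 1)
    (fun l => ⟨hmul l l le_rfl, hsa l⟩) hmul
    (fun x l => by
      rw [hPm, map_measureReal_apply hφ measurableSet_Iic]
      congr 1
      refine measureReal_congr ((hnull x).mono fun t ht => propext ?_)
      change q l t = 1 ↔ (t : ℝ)⁻¹ - 1 ≤ l
      rw [hq1, sub_le_iff_le_add', inv_le_iff_one_le_mul₀ ht])
    (fun x => by
      rw [map_measureReal_apply hφ MeasurableSet.univ, preimage_univ, vectorMeasure_real_univ])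
  refine ⟨E, fun x => ?_, fun x => ?_⟩
  · rw [hE, Measure.map_apply hφ measurableSet_Iio, measure_eq_zero_iff_ae_notMem]
    refine (hnull x).mono fun t ht => ?_
    simp only [mem_preimage, mem_Iio, not_lt, sub_nonneg]
    exact (one_le_inv₀ ht).2 (hmem t.2).2
  · let j : C(spectrum ℝ R, ℝ) := ⟨fun t => t, by fun_prop⟩
    have hj : cfcHom hR j = R := cfcHom_id hR
    have h1 := inner_cfcHom hR j x
    have h2 : Measurable fun t : ℝ => (1 + |t|)⁻¹ := by fun_prop
    rw [hj] at h1
    rw [h1, integral_complex_ofReal, hE, integral_map hφ.aemeasurable h2.aestronglyMeasurable]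
    congr 1
    refine integral_congr_ae ((hnull x).mono fun t ht => ?_)
    change (t : ℝ) = (1 + |(t : ℝ)⁻¹ - 1|)⁻¹
    rw [abs_of_nonneg (sub_nonneg.2 ((one_le_inv₀ ht).2 (hmem t.2).2))]
    simp

/-- An operator `T` with a bounded positive injective resolvent `R = (1 + T)⁻¹` has a spectral
resolution. -/
theorem exists_isResolutionOf {R : H →L[ℂ] H} (hR0 : 0 ≤ R) (hR1 : ‖R‖ ≤ 1)
    (hinj : ∀ x, R x = 0 → x = 0) {T : H →ₗ.[ℂ] H}
    (hT : ∀ x y, (x, y) ∈ T.graph ↔ x = R (x + y)) :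
    ∃ E : SpectralFamily H, E.IsResolutionOf T := by
  obtain ⟨E, hE0, hE⟩ := exists_spectralFamily hR0 hR1 hinj
  have hpos : ∀ t : ℝ, 0 < 1 + |t| := fun t => by positivity
  -- The absolute value keeps the function bounded on the whole line; `E` lives on `[0, ∞)`, where
  -- it is `(1 + t)⁻¹`.
  have hb : IsBddMeasurable fun t => (((1 + |t|)⁻¹ : ℝ) : ℂ) := by
    refine ⟨by fun_prop, 1, fun t => ?_⟩
    rw [Complex.norm_real, Real.norm_of_nonneg (inv_nonneg.2 (hpos t).le)]
    exact inv_le_one_of_one_le₀ (by simp)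
  have hb' : IsBddMeasurable fun t : ℝ => (t : ℂ) * (((1 + |t|)⁻¹ : ℝ) : ℂ) := by
    refine ⟨Complex.measurable_ofReal.mul hb.1, 1, fun t => ?_⟩
    rw [norm_mul, Complex.norm_real, Complex.norm_real,
      Real.norm_of_nonneg (inv_nonneg.2 (hpos t).le), ← div_eq_mul_inv, div_le_one (hpos t)]
    simp
  have hdom : ∀ x, x ∈ T.domain ↔ ∃ w, R w = x := fun x => by
    rw [LinearPMap.mem_domain_iff]
    constructor
    · rintro ⟨y, hy⟩
      exact ⟨_, ((hT x y).1 hy).symm⟩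
    · rintro ⟨w, rfl⟩
      exact ⟨w - R w, (hT _ _).2 (by rw [add_sub_cancel])⟩
  refine ⟨E, fun x => ?_, fun x => ?_⟩
  · rw [hdom]
    constructor
    · rintro ⟨w, rfl⟩
      rw [hE.integrable_iff hb]
      refine ((hb'.mul hb'.conj).integrable (E.measure w)).norm.congr (ae_of_all _ fun t => ?_)
      simp only [norm_mul, RCLike.norm_conj, Complex.norm_real, Real.norm_eq_abs]
      rw [← sq_abs t]
      ring
    · intro hx
      -- A preimage of `x` under `R` is found as the limit of truncations of `1 + |t|` applied to
      -- `x`. They converge because `1 + |t|` is square integrable for the measure of `x`, and `R`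
      -- maps them to truncations of `x`.
      have hs : ∀ n : ℕ, MeasurableSet (Icc (-(n : ℝ)) n) := fun n => measurableSet_Icc
      have hG : ∀ n : ℕ, IsBddMeasurable
          ((Icc (-(n : ℝ)) n).indicator fun t => ((1 + |t| : ℝ) : ℂ)) := fun n => by
        refine ⟨Measurable.indicator (by fun_prop) (hs n), 1 + n, fun t => ?_⟩
        by_cases ht : t ∈ Icc (-(n : ℝ)) n
        · rw [indicator_of_mem ht, Complex.norm_real, Real.norm_of_nonneg (hpos t).le]
          gcongr
          exact abs_le.2 ht
        · rw [indicator_of_notMem ht, norm_zero]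
          positivity
      have hlim : ∀ (g : ℝ → ℂ) t, Tendsto (fun n : ℕ => (Icc (-(n : ℝ)) n).indicator g t) atTop
          (𝓝 (g t)) := fun g t => by
        refine tendsto_const_nhds.congr' ?_
        obtain ⟨N, hN⟩ := exists_nat_ge |t|
        filter_upwards [eventually_ge_atTop N] with n hn
        rw [indicator_of_mem]
        exact abs_le.1 (hN.trans (Nat.cast_le.2 hn))
      choose W hW using fun n => E.exists_represents (hG n)
      obtain ⟨w, hw⟩ := SpectralFamily.exists_tendsto_apply hW hG x (fun t => 1 + |t|)
        (by
          refine ((integrable_const (2 : ℝ)).add (hx.const_mul 2)).mono' (by fun_prop)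
            (ae_of_all _ fun t => ?_)
          rw [Real.norm_of_nonneg (by positivity)]
          simp only [Pi.add_apply]
          rw [← sq_abs t]
          nlinarith [sq_nonneg (1 - |t|)])
        (fun n t => (norm_indicator_le_norm_self _ _).trans (by
          rw [Complex.norm_real, Real.norm_of_nonneg (hpos t).le]))
        (hlim _)
      refine ⟨w, ?_⟩
      have hRW : ∀ n : ℕ, E.Represents ((Icc (-(n : ℝ)) n).indicator fun _ => 1) (R * W n) :=
        fun n => by
        convert hE.mul hb (hW n) (hG n) using 2 with t
        by_cases ht : t ∈ Icc (-(n : ℝ)) n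
        · rw [indicator_of_mem ht, indicator_of_mem ht, ← Complex.ofReal_mul,
            inv_mul_cancel₀ (hpos t).ne', Complex.ofReal_one]
        · rw [indicator_of_notMem ht, indicator_of_notMem ht, mul_zero]
      obtain ⟨U, hU, hUlim⟩ := SpectralFamily.exists_represents_of_tendsto hRW
        (fun n => measurable_const.indicator (hs n)) 1
        (fun n t => (norm_indicator_le_norm_self _ _).trans (by simp)) (hlim _)
      have h1 : U = (1 : ℂ) • 1 := hU.unique (E.represents_const 1)
      have h2 := hUlim x
      rw [h1] at h2
      simpa using tendsto_nhds_unique ((R.continuous.tendsto _).comp hw) h2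
  · obtain ⟨w, hw⟩ := (hdom x).1 x.2
    have h1 := (hT x (T x)).1 (T.mem_graph x)
    have h2 : T x = w - R w := by
      have h3 : w = (x : H) + T x := by
        refine sub_eq_zero.1 (hinj _ ?_)
        rw [map_sub, hw, ← h1, sub_self]
      rw [hw, h3, add_sub_cancel_left]
    -- With `x = R w` and `T x = w - R w`, the form becomes an integral over the spectral measure of
    -- `w`; on `t ≥ 0` its integrand is `t (1 + t)⁻²`.
    have h3 := (hE.adjoint.mul hb.conj (((E.represents_const 1).sub (.const 1) hE hb))
      ((IsBddMeasurable.const 1).sub hb)) w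
    rw [mul_apply_eq_comp, ContinuousLinearMap.adjoint_inner_right] at h3
    have h4 : ((1 : ℂ) • (1 : H →L[ℂ] H) - R) w = w - R w := by simp
    rw [h4, ← h2, hw] at h3
    rw [h3, ← hw, hE.integral_eq hb, ← integral_complex_ofReal]
    refine integral_congr_ae ((measure_eq_zero_iff_ae_notMem.1 (hE0 w)).mono fun t ht => ?_)
    simp only [mem_Iio, not_lt] at ht
    simp only [Complex.conj_ofReal, Complex.norm_real, Real.norm_eq_abs, sq_abs, abs_of_nonneg ht]
    norm_cast
    have := hpos t
    rw [abs_of_nonneg ht] at this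
    field_simp
    ring

/-! ### The relative Tomita operator -/

section Tomita

variable {A : VonNeumannAlgebra H} {Ψ Φ : H}

theorem apply_comm_of_mem_commutant {a b : H →L[ℂ] H} (ha : a ∈ A) (hb : b ∈ A.commutant) (x : H) :
    a (b x) = b (a x) :=
  congrArg (fun T : H →L[ℂ] H => T x) (VonNeumannAlgebra.mem_commutant_iff.1 hb a ha)

/-- A separating vector is cyclic for the commutant. -/
theorem IsSeparating.isCyclic_commutant (hs : IsSeparating A Ψ) : IsCyclic A.commutant Ψ := by
  let K₀ : Submodule ℂ H :=
    { carrier := {x | ∃ a ∈ A.commutant, x = a Ψ}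
      zero_mem' := ⟨0, zero_mem _, by simp⟩
      add_mem' := by
        rintro _ _ ⟨a, ha, rfl⟩ ⟨b, hb, rfl⟩
        exact ⟨a + b, add_mem ha hb, by simp⟩
      smul_mem' := by
        rintro c _ ⟨a, ha, rfl⟩
        exact ⟨c • a, A.commutant.toStarSubalgebra.smul_mem ha c, by simp⟩ }
  let K := K₀.topologicalClosure
  have hKc : IsClosed (K : Set H) := K₀.isClosed_topologicalClosure
  have : CompleteSpace K := hKc.completeSpace_coe
  have hinv : ∀ b ∈ A.commutant, ∀ x ∈ K, b x ∈ K := by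
    intro b hb x hx
    refine map_mem_closure b.continuous hx ?_
    rintro _ ⟨a, ha, rfl⟩
    exact ⟨b * a, mul_mem hb ha, rfl⟩
  -- `K` is invariant under the commutant, so its projection lies in `A`. Its complement annihilates
  -- `Ψ` and is therefore zero.
  have hmem : K.starProjection ∈ A := by
    rw [VonNeumannAlgebra.IsStarProjection.mem_iff isStarProjection_starProjection]
    intro b hb
    rw [Module.End.mem_invtSubmodule]
    intro x hx
    rw [Submodule.range_starProjection] at hx
    rw [Submodule.range_starProjection]
    exact hinv b hb x hx
  have hΨ : Ψ ∈ K := K₀.le_topologicalClosure ⟨1, one_mem _, rfl⟩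
  have h1 := hs (1 - K.starProjection) (sub_mem (one_mem _) hmem) (by
    simp [Submodule.starProjection_eq_self_iff.2 hΨ])
  intro x
  change x ∈ K
  rw [← Submodule.starProjection_eq_self_iff, ← sub_eq_zero.1 h1]
  rfl

theorem IsCyclic.star_dense (hc : IsCyclic A Ψ) : Dense {x : H | ∃ a ∈ A, x = (star a) Ψ} := by
  refine hc.mono ?_
  rintro _ ⟨a, ha, rfl⟩
  exact ⟨star a, star_mem ha, by simp⟩

theorem mem_tomitaGraph {a : H →L[ℂ] H} (ha : a ∈ A) : (a Ψ, (star a) Φ) ∈ tomitaGraph A Ψ Φ :=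
  (preTomitaGraph A Ψ Φ).le_topologicalClosure ⟨a, ha, rfl⟩

theorem isClosed_tomitaGraph : IsClosed (tomitaGraph A Ψ Φ : Set (H × H)) :=
  (preTomitaGraph A Ψ Φ).isClosed_topologicalClosure

/-- The relation `⟨S x, b Ψ⟩ = ⟨b† Φ, x⟩` for `b` in the commutant. -/
theorem inner_tomitaGraph {x y : H} (h : (x, y) ∈ tomitaGraph A Ψ Φ) {b : H →L[ℂ] H}
    (hb : b ∈ A.commutant) : ⟪y, b Ψ⟫ = ⟪(star b) Φ, x⟫ := by
  have hcl : IsClosed {p : H × H | ⟪p.2, b Ψ⟫ = ⟪(star b) Φ, p.1⟫} :=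
    isClosed_eq (by fun_prop) (by fun_prop)
  refine closure_minimal ?_ hcl h
  rintro _ ⟨a, ha, rfl⟩
  change ⟪(star a) Φ, b Ψ⟫ = ⟪(star b) Φ, a Ψ⟫
  rw [ContinuousLinearMap.star_eq_adjoint, ContinuousLinearMap.star_eq_adjoint,
    ContinuousLinearMap.adjoint_inner_left, ContinuousLinearMap.adjoint_inner_left,
    apply_comm_of_mem_commutant ha hb]

/-- Closability: `y` is orthogonal to every `b Ψ` with `b` in the commutant, and these vectors are
dense. -/
theorem tomitaGraph_snd_eq_zero (hΨs : IsSeparating A Ψ) {y : H}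
    (h : (0, y) ∈ tomitaGraph A Ψ Φ) : y = 0 := by
  refine hΨs.isCyclic_commutant.eq_zero_of_inner_left ℂ ?_
  rintro _ ⟨b, hb, rfl⟩
  rw [inner_tomitaGraph h hb, inner_zero_right]

/-- Injectivity of `S`, by the same pairing read on the other side: `x` is orthogonal to every `b†
Φ`. -/
theorem tomitaGraph_fst_eq_zero (hΦs : IsSeparating A Φ) {x : H}
    (h : (x, 0) ∈ tomitaGraph A Ψ Φ) : x = 0 := by
  refine hΦs.isCyclic_commutant.star_dense.eq_zero_of_inner_right ℂ ?_
  rintro _ ⟨b, hb, rfl⟩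
  rw [← inner_tomitaGraph h hb, inner_zero_left]

theorem adjointGraph_snd_eq_zero (hΨc : IsCyclic A Ψ) {z : H}
    (h : (0, z) ∈ antilinearAdjointGraph (tomitaGraph A Ψ Φ)) : z = 0 := by
  refine hΨc.eq_zero_of_inner_right ℂ ?_
  rintro _ ⟨a, ha, rfl⟩
  rw [h _ (mem_tomitaGraph ha), inner_zero_left]

/-- The graph of an antilinear operator is only a real subspace of `H × H`, so the projection onto
it is taken over `ℝ`. -/
theorem exists_mem_forall_inner_sub_eq_zero {V : Type*} [NormedAddCommGroup V]
    [InnerProductSpace ℝ V] [CompleteSpace V] {S : Set V} (hS : IsClosed S) (h0 : 0 ∈ S)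
    (hadd : ∀ x ∈ S, ∀ y ∈ S, x + y ∈ S) (hsmul : ∀ (c : ℝ), ∀ x ∈ S, c • x ∈ S) (v : V) :
    ∃ p ∈ S, ∀ w ∈ S, inner ℝ (v - p) w = 0 := by
  let K : Submodule ℝ V :=
    { carrier := S
      zero_mem' := h0
      add_mem' := fun hx hy => hadd _ hx _ hy
      smul_mem' := fun c x hx => hsmul c x hx }
  have hK : IsClosed (K : Set V) := hS
  have : CompleteSpace K := hK.completeSpace_coe
  exact ⟨K.starProjection v, K.starProjection_apply_mem v,
    fun w hw => K.starProjection_inner_eq_zero v w hw⟩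

/-- For the closed operator `S` every vector is of the form `y + S† S y`. -/
theorem exists_add_eq (x : H) : ∃ y s, (y, s) ∈ tomitaGraph A Ψ Φ ∧
    (s, x - y) ∈ antilinearAdjointGraph (tomitaGraph A Ψ Φ) := by
  let : InnerProductSpace ℝ H := InnerProductSpace.complexToReal
  -- If `(y, s)` is the projection of `(x, 0)` onto the graph, then `(x - y, -s)` is orthogonal to
  -- the graph, which says `S† s = x - y`.
  let v : WithLp 2 (H × H) := WithLp.toLp 2 (x, 0)
  obtain ⟨p, hp, hperp⟩ := exists_mem_forall_inner_sub_eq_zero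
    (S := {p : WithLp 2 (H × H) | p.ofLp ∈ tomitaGraph A Ψ Φ})
    (isClosed_tomitaGraph.preimage (WithLp.prod_continuous_ofLp 2 H H))
    (tomitaGraph A Ψ Φ).zero_mem (fun _ hp _ hq => (tomitaGraph A Ψ Φ).add_mem hp hq)
    (fun c p hp => by
      have h1 := tomitaGraph_smul A Ψ Φ c p.ofLp.1 p.ofLp.2 hp
      rw [Complex.conj_ofReal] at h1
      exact h1) v
  have key : ∀ u w, (u, w) ∈ tomitaGraph A Ψ Φ →
      (⟪u, x - p.ofLp.1⟫).re = (⟪p.ofLp.2, w⟫).re := by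
    intro u w h
    have h1 := hperp (WithLp.toLp 2 (u, w)) h
    rw [WithLp.prod_inner_apply, real_inner_eq_re_inner ℂ, real_inner_eq_re_inner ℂ] at h1
    have h2 : (⟪x - p.ofLp.1, u⟫).re + (⟪0 - p.ofLp.2, w⟫).re = 0 := h1
    rw [zero_sub, inner_neg_left, Complex.neg_re, ← inner_conj_symm, Complex.conj_re] at h2
    linarith
  refine ⟨p.ofLp.1, p.ofLp.2, hp, ?_⟩
  rintro ⟨u, w⟩ h
  refine Complex.ext (key u w h) ?_
  -- Real orthogonality controls only real parts; testing with `(i u, -i w)` supplies the imaginary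
  -- part.
  have h1 := key _ _ (tomitaGraph_smul A Ψ Φ Complex.I u w h)
  rw [inner_smul_left, inner_smul_right] at h1
  simpa [inner_sub_right] using h1

/-! ### The relative modular operator: positivity, resolvent, form domain -/

theorem modularGraph_inner {x y z : H} (h : (x, y) ∈ tomitaGraph A Ψ Φ)
    (h' : (y, z) ∈ antilinearAdjointGraph (tomitaGraph A Ψ Φ)) :
    ⟪x, z⟫ = ((‖y‖ ^ 2 : ℝ) : ℂ) := by
  have h1 : ⟪x, z⟫ = ⟪y, y⟫ := h' _ h
  rw [h1, inner_self_eq_norm_sq_to_K]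
  push_cast
  rfl

/-- Since `⟪x, Δ x⟫ = ‖S x‖² ≥ 0`, the number `-1` is not an eigenvalue of `Δ`. -/
theorem modularGraph_eq_zero_of_add {x z : H} (h : (x, z) ∈ modularGraph A Ψ Φ)
    (h0 : x + z = 0) : x = 0 := by
  obtain ⟨y, h1, h2⟩ := h
  have h3 := modularGraph_inner h1 h2
  have h4 : z = -x := by rw [← sub_eq_zero]; simpa [add_comm] using h0
  change ⟪x, z⟫ = _ at h3
  rw [h4, inner_neg_right, inner_self_eq_norm_sq_to_K] at h3
  have h5 : -‖x‖ ^ 2 = ‖y‖ ^ 2 := Complex.ofReal_injective (by rw [← h3]; push_cast; rfl)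
  have h6 : ‖x‖ ^ 2 = 0 := by nlinarith [sq_nonneg ‖x‖, sq_nonneg ‖y‖]
  simpa using h6

/-- `Submodule.toLinearPMap` is known to return the given graph only for a single-valued relation.
Here `S` is single-valued as `Ψ` is separating, and `S†` as `Ψ` is cyclic. -/
theorem modularOperator_graph (hΨc : IsCyclic A Ψ) (hΨs : IsSeparating A Ψ) :
    (modularOperator A Ψ Φ).graph = modularGraph A Ψ Φ := by
  refine Submodule.toLinearPMap_graph_eq _ ?_
  rintro ⟨x, z⟩ ⟨y, h1, h2⟩ h0
  change x = 0 at h0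
  change (x, y) ∈ _ at h1
  subst h0
  obtain rfl := tomitaGraph_snd_eq_zero hΨs h1
  exact adjointGraph_snd_eq_zero hΨc h2

theorem exists_mem_of_mem_domain (hΨc : IsCyclic A Ψ) (hΨs : IsSeparating A Ψ)
    (x : (modularOperator A Ψ Φ).domain) : ∃ y, ((x : H), y) ∈ tomitaGraph A Ψ Φ ∧
      (y, modularOperator A Ψ Φ x) ∈ antilinearAdjointGraph (tomitaGraph A Ψ Φ) := by
  have h1 := (modularOperator A Ψ Φ).mem_graph x
  rwa [modularOperator_graph hΨc hΨs] at h1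

theorem modularOperator_inner_pos (hΨc : IsCyclic A Ψ) (hΨs : IsSeparating A Ψ)
    (hΦs : IsSeparating A Φ) (x : (modularOperator A Ψ Φ).domain) (hx : (x : H) ≠ 0) :
    0 < (⟪(x : H), modularOperator A Ψ Φ x⟫).re := by
  obtain ⟨y, h1, h2⟩ := exists_mem_of_mem_domain hΨc hΨs x
  rw [modularGraph_inner h1 h2, Complex.ofReal_re]
  have hy : y ≠ 0 := by
    rintro rfl
    exact hx (tomitaGraph_fst_eq_zero hΦs h1)
  positivity

/-- The resolvent `(1 + Δ)⁻¹` of the relative modular operator. -/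
theorem exists_modular_resolvent (hΨc : IsCyclic A Ψ) (hΨs : IsSeparating A Ψ) :
    ∃ R : H →L[ℂ] H, 0 ≤ R ∧ ‖R‖ ≤ 1 ∧ (∀ x, R x = 0 → x = 0) ∧
      ∀ x y, (x, y) ∈ (modularOperator A Ψ Φ).graph ↔ x = R (x + y) := by
  choose r s hr hs using fun x => exists_add_eq (A := A) (Ψ := Ψ) (Φ := Φ) x
  have hmem : ∀ x, (r x, x - r x) ∈ modularGraph A Ψ Φ := fun x => ⟨s x, hr x, hs x⟩
  -- Uniqueness of the decomposition makes the chosen `r` linear.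
  have huniq : ∀ x y, (x, y) ∈ modularGraph A Ψ Φ → x = r (x + y) := by
    intro x y h
    have h1 := (modularGraph A Ψ Φ).sub_mem h (hmem (x + y))
    exact sub_eq_zero.1 (modularGraph_eq_zero_of_add h1 (by simp only; abel))
  have hinner : ∀ x, ⟪r x, x⟫ = ((‖r x‖ ^ 2 + ‖s x‖ ^ 2 : ℝ) : ℂ) := by
    intro x
    have h1 := modularGraph_inner (hr x) (hs x)
    rw [inner_sub_right, inner_self_eq_norm_sq_to_K, sub_eq_iff_eq_add] at h1
    rw [h1, Complex.ofReal_add, add_comm]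
    push_cast
    rfl
  have hnorm : ∀ x, ‖r x‖ ≤ 1 * ‖x‖ := by
    intro x
    have h1 : ‖⟪r x, x⟫‖ ≤ ‖r x‖ * ‖x‖ := norm_inner_le_norm _ _
    rw [hinner, Complex.norm_real, Real.norm_of_nonneg (by positivity)] at h1
    rcases (norm_nonneg (r x)).eq_or_lt with h2 | h2
    · rw [← h2]; positivity
    · nlinarith [sq_nonneg ‖s x‖]
  let L : H →ₗ[ℂ] H :=
    { toFun := r
      map_add' := fun x y => by
        have h1 := huniq _ _ ((modularGraph A Ψ Φ).add_mem (hmem x) (hmem y))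
        rw [h1]
        congr 1
        simp only
        abel
      map_smul' := fun c x => by
        have h1 := huniq _ _ ((modularGraph A Ψ Φ).smul_mem c (hmem x))
        rw [RingHom.id_apply, h1]
        congr 1
        rw [← smul_add, add_sub_cancel] }
  refine ⟨L.mkContinuous 1 hnorm, ?_, L.mkContinuous_norm_le zero_le_one hnorm, ?_, ?_⟩
  · rw [ContinuousLinearMap.nonneg_iff_isPositive, ContinuousLinearMap.isPositive_iff_complex]
    intro x
    have h1 : ⟪L.mkContinuous 1 hnorm x, x⟫ = ((‖r x‖ ^ 2 + ‖s x‖ ^ 2 : ℝ) : ℂ) := hinner x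
    rw [h1]
    refine ⟨rfl, ?_⟩
    change 0 ≤ ‖r x‖ ^ 2 + ‖s x‖ ^ 2
    positivity
  · intro x hx
    change r x = 0 at hx
    have h1 := hr x
    have h2 := hs x
    rw [hx] at h1 h2
    rw [tomitaGraph_snd_eq_zero hΨs h1] at h2
    simpa using adjointGraph_snd_eq_zero hΨc h2
  · intro x y
    rw [modularOperator_graph hΨc hΨs]
    refine ⟨huniq x y, fun h => ?_⟩
    change x = r (x + y) at h
    have h1 := hmem (x + y)
    rwa [← h, add_sub_cancel_left] at h1

/-- The relative modular operator has a spectral resolution. -/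
theorem exists_isResolutionOf_modularOperator (hΨc : IsCyclic A Ψ) (hΨs : IsSeparating A Ψ) :
    ∃ E : SpectralFamily H, E.IsResolutionOf (modularOperator A Ψ Φ) := by
  obtain ⟨R, h0, h1, hinj, hT⟩ := exists_modular_resolvent (Φ := Φ) hΨc hΨs
  exact exists_isResolutionOf h0 h1 hinj hT

/-- The domain of `S` is contained in the form domain of `Δ`, and `‖S x‖² = ∫ l d⟨x, E_l x⟩`. -/
theorem integral_measure_of_mem_tomitaGraph (hΨc : IsCyclic A Ψ) (hΨs : IsSeparating A Ψ)
    (hΦs : IsSeparating A Φ) {E : SpectralFamily H}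
    (hE : E.IsResolutionOf (modularOperator A Ψ Φ)) {x s : H}
    (hxs : (x, s) ∈ tomitaGraph A Ψ Φ) :
    Integrable (fun l => l) (E.measure x) ∧ ∫ l, l ∂(E.measure x) = ‖s‖ ^ 2 := by
  have hpos : ∀ᵐ l ∂(E.measure x), 0 < l :=
    (measure_eq_zero_iff_ae_notMem.1 (hE.measure_Iic_zero
      (modularOperator_inner_pos hΨc hΨs hΦs) x)).mono fun l hl => by simpa using hl
  let J : ℕ → Set ℝ := fun n => Icc (-(n : ℝ)) n
  have hJ : ∀ n, MeasurableSet (J n) := fun n => measurableSet_Icc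
  have hcov : AECover (E.measure x) atTop J :=
    aecover_Icc (tendsto_neg_atTop_atBot.comp tendsto_natCast_atTop_atTop)
      tendsto_natCast_atTop_atTop
  let a : ℕ → ℝ := fun n => ∫ l in J n, l ∂(E.measure x)
  have hb : ∀ n, IsBddMeasurable ((J n).indicator fun _ => 1) :=
    fun n => (IsBddMeasurable.const 1).indicator (hJ n)
  have hb' : ∀ n, IsBddMeasurable fun l : ℝ => (l : ℂ) * (J n).indicator (fun _ => 1) l := by
    intro n
    refine ⟨Complex.measurable_ofReal.mul (hb n).1, n, fun t => ?_⟩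
    by_cases ht : t ∈ J n
    · simp only [ht, indicator_of_mem, mul_one, Complex.norm_real]
      exact abs_le.2 ht
    · simp [ht]
  choose U hU using fun n => E.exists_represents (hb n)
  choose V hV using fun n => E.exists_represents (hb' n)
  have hdom := fun n => hE.apply_mem_domain (hU n) (hb n) (hb' n) x
  have hΔ : ∀ n, modularOperator A Ψ Φ ⟨U n x, hdom n⟩ = V n x :=
    fun n => hE.apply_eq (hU n) (hb n) (hV n) (hb' n) x _
  -- Here `t n = S (U n x)`, and `U n x` is the spectral truncation of `x` to `[-n, n]`. Pairing
  -- through `S†` gives `⟪t m, t n⟫ = a (min m n)` and `⟪t n, s⟫ = a n`.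
  choose t ht htadj using fun n => exists_mem_of_mem_domain hΨc hΨs ⟨U n x, hdom n⟩
  simp only [hΔ] at htadj
  have hVx : ∀ n, ⟪x, V n x⟫ = (a n : ℂ) := by
    intro n
    rw [hV n x]
    simp only [a]
    rw [← integral_indicator (hJ n), ← integral_complex_ofReal]
    congr 1 with l
    by_cases hl : l ∈ J n <;> simp [hl]
  have hUV : ∀ m n, m ≤ n → ⟪U m x, V n x⟫ = (a m : ℂ) ∧ ⟪U n x, V m x⟫ = (a m : ℂ) := by
    intro m n hmn
    have hsub : J m ⊆ J n := by
      have : (m : ℝ) ≤ n := Nat.cast_le.2 hmn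
      exact Icc_subset_Icc (neg_le_neg this) this
    have key : ∀ p q, (∀ l : ℝ, (J p).indicator (fun _ => (1 : ℂ)) l *
        ((l : ℂ) * (J q).indicator (fun _ => (1 : ℂ)) l) =
        (l : ℂ) * (J m).indicator (fun _ => (1 : ℂ)) l) → ⟪U p x, V q x⟫ = (a m : ℂ) := by
      intro p q hpq
      have h1 := ((hU p).adjoint.mul (hb p).conj (hV q) (hb' q)) x
      rw [mul_apply_eq_comp, ContinuousLinearMap.adjoint_inner_right] at h1
      rw [h1, ← hVx, hV m x]
      congr 1 with l
      refine Eq.trans ?_ (hpq l)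
      by_cases hl : l ∈ J p <;> simp [hl]
    constructor
    · refine key m n fun l => ?_
      by_cases hl : l ∈ J m
      · simp [hl, hsub hl]
      · simp [hl]
    · refine key n m fun l => ?_
      by_cases hl : l ∈ J m
      · simp [hl, hsub hl]
      · simp [hl]
  have htt : ∀ m n, m ≤ n → ⟪t m, t n⟫ = (a m : ℂ) := by
    intro m n hmn
    rw [← (hUV m n hmn).2]
    exact (htadj m _ (ht n)).symm
  have hnt : ∀ n, ‖t n‖ ^ 2 = a n := by
    intro n
    have h1 := htt n n le_rfl
    rw [inner_self_eq_norm_sq_to_K] at h1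
    exact Complex.ofReal_injective (by rw [← h1]; push_cast; rfl)
  have hts : ∀ n, ⟪t n, s⟫ = (a n : ℂ) := by
    intro n
    rw [← hVx]
    exact (htadj n _ hxs).symm
  -- Bessel's inequality: `‖t n - s‖² = ‖s‖² - a n`. This bounds the truncated moments and yields
  -- integrability.
  have hale : ∀ n, a n ≤ ‖s‖ ^ 2 := by
    intro n
    have h1 := @norm_sub_sq ℂ H _ _ _ (t n) s
    rw [hts, hnt, RCLike.re_eq_complex_re, Complex.ofReal_re] at h1
    nlinarith [sq_nonneg ‖t n - s‖]
  have hint : Integrable (fun l => l) (E.measure x) := by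
    refine hcov.integrable_of_integral_norm_bounded (‖s‖ ^ 2) (fun n => ?_)
      (Eventually.of_forall fun n => ?_)
    · exact continuous_id.continuousOn.integrableOn_compact isCompact_Icc
    · refine le_trans (le_of_eq ?_) (hale n)
      refine setIntegral_congr_ae (hJ n) (hpos.mono fun l hl _ => ?_)
      exact Real.norm_of_nonneg hl.le
  refine ⟨hint, ?_⟩
  have halim : Tendsto a atTop (𝓝 (∫ l, l ∂(E.measure x))) :=
    hcov.integral_tendsto_of_countably_generated hint
  have hmono : ∀ m n, m ≤ n → ‖t n - t m‖ ^ 2 = a n - a m := by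
    intro m n hmn
    have h1 := @norm_sub_sq ℂ H _ _ _ (t n) (t m)
    rw [← inner_conj_symm, htt m n hmn, Complex.conj_ofReal, hnt, hnt, RCLike.re_eq_complex_re,
      Complex.ofReal_re] at h1
    rw [h1]
    ring
  have hdiff : ∀ p : ℕ × ℕ, ‖t p.1 - t p.2‖ ^ 2 = |a p.1 - a p.2| := by
    rintro ⟨m, n⟩
    rcases le_total m n with h | h
    · have h1 := hmono m n h
      rw [norm_sub_rev, h1, abs_sub_comm, abs_of_nonneg]
      rw [← h1]; positivity
    · have h1 := hmono n m h
      rw [h1, abs_of_nonneg]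
      rw [← h1]; positivity
  have hcau : CauchySeq t := by
    rw [cauchySeq_iff_tendsto_dist_atTop_0]
    have h1 : Tendsto (fun p : ℕ × ℕ => |a p.1 - a p.2|) atTop (𝓝 0) := by
      rw [← prod_atTop_atTop_eq]
      simpa using ((halim.comp tendsto_fst).sub (halim.comp tendsto_snd)).abs
    simp only [← hdiff] at h1
    simpa [dist_eq_norm, Real.sqrt_sq (norm_nonneg _)] using h1.sqrt
  obtain ⟨s', hs'⟩ := cauchySeq_tendsto_of_complete hcau
  have hUx : Tendsto (fun n => U n x) atTop (𝓝 x) := by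
    obtain ⟨W, hW, hWlim⟩ := SpectralFamily.exists_represents_of_tendsto hU (fun n => (hb n).1) 1
      (fun n l => (norm_indicator_le_norm_self _ _).trans (by simp)) (g := fun _ => 1)
      (fun l => by
        refine tendsto_const_nhds.congr' ?_
        obtain ⟨N, hN⟩ := exists_nat_ge |l|
        filter_upwards [eventually_ge_atTop N] with n hn
        rw [indicator_of_mem]
        exact abs_le.1 (hN.trans (Nat.cast_le.2 hn)))
    have h1 := hWlim x
    rw [hW.unique (E.represents_const 1)] at h1
    simpa using h1
  -- Closedness of `S` identifies the limit of `t n` with `S x`, so `‖t n‖² = a n` passes to the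
  -- limit.
  have hmem : (x, s') ∈ tomitaGraph A Ψ Φ :=
    isClosed_tomitaGraph.mem_of_tendsto (hUx.prodMk_nhds hs') (Eventually.of_forall ht)
  have hss : s = s' := by
    have h1 := (tomitaGraph A Ψ Φ).sub_mem hxs hmem
    rw [Prod.mk_sub_mk, sub_self] at h1
    exact sub_eq_zero.1 (tomitaGraph_snd_eq_zero hΨs h1)
  rw [hss]
  refine tendsto_nhds_unique halim ((hs'.norm.pow 2).congr hnt)

end Tomita

/-! ### Difference quotients of moment generating functions at the boundary -/

section BoundaryMGF

open ProbabilityTheory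

/-- The exponential lies below its chord. This bounds the difference quotients at `0` by `exp x -
1`, uniformly in `β`. -/
theorem exp_mul_sub_one_le {β : ℝ} (h0 : 0 ≤ β) (h1 : β ≤ 1) (x : ℝ) :
    Real.exp (β * x) - 1 ≤ β * (Real.exp x - 1) := by
  have h := convexOn_exp.2 (mem_univ 0) (mem_univ x) (sub_nonneg.2 h1) h0 (by ring)
  simp only [smul_eq_mul, mul_zero, zero_add, Real.exp_zero, mul_one] at h
  linarith

theorem exp_mul_le_one_add_exp {β : ℝ} (h0 : 0 ≤ β) (h1 : β ≤ 1) (x : ℝ) :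
    Real.exp (β * x) ≤ 1 + Real.exp x := by
  have h := exp_mul_sub_one_le h0 h1 x
  nlinarith [Real.exp_pos x]

theorem tendsto_exp_mul_sub_one_div (u : ℝ) :
    Tendsto (fun β : ℝ => (Real.exp (β * u) - 1) / β) (𝓝[>] 0) (𝓝 u) := by
  have h1 : HasDerivAt (fun β : ℝ => Real.exp (β * u)) u 0 := by
    have h2 := ((hasDerivAt_id (0 : ℝ)).mul_const u).exp
    simpa using h2
  have h2 := (hasDerivAt_iff_tendsto_slope_zero.1 h1).mono_left
    (nhdsWithin_mono 0 fun x (hx : 0 < x) => hx.ne')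
  refine h2.congr fun β => ?_
  simp [div_eq_inv_mul]

variable {Ω : Type*} [MeasurableSpace Ω] {ρ : Measure Ω} {X : Ω → ℝ}

theorem integrable_max_zero (hX : Measurable X)
    (hint : Integrable (fun ω => Real.exp (X ω)) ρ) : Integrable (fun ω => max (X ω) 0) ρ := by
  refine hint.mono' (by fun_prop) (ae_of_all _ fun ω => ?_)
  rw [Real.norm_of_nonneg (le_max_right _ _)]
  exact max_le ((le_add_of_nonneg_right zero_le_one).trans (Real.add_one_le_exp _))
    (Real.exp_pos _).le

theorem lintegral_ofReal_lt_top (hX : Measurable X)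
    (hint : Integrable (fun ω => Real.exp (X ω)) ρ) : ∫⁻ ω, ENNReal.ofReal (X ω) ∂ρ < ⊤ := by
  refine lt_of_le_of_lt (lintegral_mono fun ω => ?_) (integrable_max_zero hX hint).lintegral_lt_top
  exact ENNReal.ofReal_le_ofReal (le_max_left _ _)

theorem tendsto_integral_exp_mul_max_sub_one_div (hX : Measurable X)
    (hint : Integrable (fun ω => Real.exp (X ω)) ρ) :
    Tendsto (fun β : ℝ => ∫ ω, (Real.exp (β * max (X ω) 0) - 1) / β ∂ρ) (𝓝[>] 0)
      (𝓝 (∫ ω, max (X ω) 0 ∂ρ)) := by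
  refine tendsto_integral_filter_of_dominated_convergence (fun ω => Real.exp (X ω))
    (Eventually.of_forall fun β => by fun_prop) ?_ hint
    (ae_of_all _ fun ω => tendsto_exp_mul_sub_one_div _)
  filter_upwards [Ioc_mem_nhdsGT (zero_lt_one (α := ℝ))] with β hβ
  refine ae_of_all _ fun ω => ?_
  have h0 : 0 ≤ max (X ω) 0 := le_max_right _ _
  have h1 : 1 ≤ Real.exp (β * max (X ω) 0) := Real.one_le_exp (mul_nonneg hβ.1.le h0)
  rw [Real.norm_of_nonneg (div_nonneg (sub_nonneg.2 h1) hβ.1.le), div_le_iff₀' hβ.1]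
  refine (exp_mul_sub_one_le hβ.1.le hβ.2 _).trans (mul_le_mul_of_nonneg_left ?_ hβ.1.le)
  rcases max_choice (X ω) 0 with h | h
  · rw [h]; linarith
  · rw [h]; linarith [Real.exp_zero, Real.exp_pos (X ω)]

/-- The limit may be infinite, so domination is not available. Fatou gives the lower bound, and `1 -
exp (-u) ≤ u` gives the upper one. -/
theorem tendsto_lintegral_one_sub_exp_div (hX : Measurable X) :
    Tendsto (fun β : ℝ => ∫⁻ ω, ENNReal.ofReal ((1 - Real.exp (-(β * max (-X ω) 0))) / β) ∂ρ)
      (𝓝[>] 0) (𝓝 (∫⁻ ω, ENNReal.ofReal (-X ω) ∂ρ)) := by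
  have hpt : ∀ ω, Tendsto
      (fun β : ℝ => ENNReal.ofReal ((1 - Real.exp (-(β * max (-X ω) 0))) / β)) (𝓝[>] 0)
      (𝓝 (ENNReal.ofReal (-X ω))) := by
    intro ω
    have h1 := (tendsto_exp_mul_sub_one_div (-max (-X ω) 0)).neg
    rw [neg_neg] at h1
    have h2 : ENNReal.ofReal (-X ω) = ENNReal.ofReal (max (-X ω) 0) := by
      rw [ENNReal.ofReal_max, ENNReal.ofReal_zero, max_eq_left zero_le]
    rw [h2]
    refine ENNReal.tendsto_ofReal (h1.congr fun β => ?_)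
    rw [← neg_div, neg_sub, mul_neg]
  refine tendsto_of_le_liminf_of_limsup_le ?_ ?_
  · refine le_trans (le_of_eq ?_) (lintegral_liminf_le fun β => by fun_prop)
    exact lintegral_congr fun ω => (hpt ω).liminf_eq.symm
  · refine limsup_le_of_le (by isBoundedDefault) ?_
    filter_upwards [self_mem_nhdsWithin] with β hβ
    refine lintegral_mono fun ω => ?_
    have h2 : ENNReal.ofReal (-X ω) = ENNReal.ofReal (max (-X ω) 0) := by
      rw [ENNReal.ofReal_max, ENNReal.ofReal_zero, max_eq_left zero_le]
    simp only [h2]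
    refine ENNReal.ofReal_le_ofReal ?_
    rw [div_le_iff₀ hβ]
    linarith [Real.add_one_le_exp (-(β * max (-X ω) 0))]

variable [IsProbabilityMeasure ρ]

theorem integrable_exp_mul_of_mem_Icc (hX : Measurable X)
    (hint : Integrable (fun ω => Real.exp (X ω)) ρ) {β : ℝ} (hβ : β ∈ Icc (0 : ℝ) 1) :
    Integrable (fun ω => Real.exp (β * X ω)) ρ := by
  refine ((integrable_const 1).add hint).mono' (by fun_prop) (ae_of_all _ fun ω => ?_)
  rw [Real.norm_of_nonneg (Real.exp_pos _).le]
  exact exp_mul_le_one_add_exp hβ.1 hβ.2 _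

theorem mgf_pos_of_mem_Icc (hX : Measurable X)
    (hint : Integrable (fun ω => Real.exp (X ω)) ρ) {β : ℝ} (hβ : β ∈ Icc (0 : ℝ) 1) :
    0 < mgf X ρ β :=
  mgf_pos (integrable_exp_mul_of_mem_Icc hX hint hβ)

theorem continuousOn_mgf_Icc (hX : Measurable X)
    (hint : Integrable (fun ω => Real.exp (X ω)) ρ) : ContinuousOn (mgf X ρ) (Icc 0 1) := by
  refine continuousOn_of_dominated (bound := fun ω => 1 + Real.exp (X ω)) (fun β _ => by fun_prop)
    (fun β hβ => ae_of_all _ fun ω => ?_) ((integrable_const 1).add hint)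
    (ae_of_all _ fun ω => by fun_prop)
  rw [Real.norm_of_nonneg (Real.exp_pos _).le]
  exact exp_mul_le_one_add_exp hβ.1 hβ.2 _

/-- The difference quotients of the moment generating function at the left endpoint of its
domain. -/
theorem tendsto_one_sub_mgf_div (hX : Measurable X)
    (hint : Integrable (fun ω => Real.exp (X ω)) ρ) :
    Tendsto (fun β : ℝ => (((1 - mgf X ρ β) / β : ℝ) : EReal)) (𝓝[>] 0)
      (𝓝 (((∫⁻ ω, ENNReal.ofReal (-X ω) ∂ρ : ENNReal) : EReal) -
        ((∫⁻ ω, ENNReal.ofReal (X ω) ∂ρ : ENNReal) : EReal))) := by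
  have hm : ((∫⁻ ω, ENNReal.ofReal (X ω) ∂ρ : ENNReal) : EReal) =
      ((∫ ω, max (X ω) 0 ∂ρ : ℝ) : EReal) := by
    rw [integral_eq_lintegral_of_nonneg_ae (f := fun ω => max (X ω) 0)
      (ae_of_all _ fun ω => le_max_right _ _) (by fun_prop),
      ← EReal.coe_ennreal_toReal (lintegral_ofReal_lt_top hX hint).ne]
    congr 3
    funext ω
    rw [ENNReal.ofReal_max, ENNReal.ofReal_zero, max_eq_left zero_le]
  have h1 := EReal.tendsto_coe_ennreal.2 (tendsto_lintegral_one_sub_exp_div (ρ := ρ) hX)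
  have h2 := (tendsto_integral_exp_mul_max_sub_one_div hX hint).neg
  have h3 : Tendsto (fun β : ℝ =>
      ((-∫ ω, (Real.exp (β * max (X ω) 0) - 1) / β ∂ρ : ℝ) : EReal)) (𝓝[>] 0)
      (𝓝 ((-∫ ω, max (X ω) 0 ∂ρ : ℝ) : EReal)) := EReal.tendsto_coe.2 h2
  -- The quotient splits according to the sign of `X`. The part from `X > 0` has a finite limit, so
  -- the sum is continuous in `EReal` even if the other part diverges.
  have h4 := (EReal.continuousAt_add
    (p := (((∫⁻ ω, ENNReal.ofReal (-X ω) ∂ρ : ENNReal) : EReal),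
      ((-∫ ω, max (X ω) 0 ∂ρ : ℝ) : EReal)))
    (Or.inr (EReal.coe_ne_bot _)) (Or.inr (EReal.coe_ne_top _))).tendsto.comp
    (h1.prodMk_nhds h3)
  rw [hm, sub_eq_add_neg, ← EReal.coe_neg]
  refine h4.congr' ?_
  filter_upwards [Ioc_mem_nhdsGT (zero_lt_one (α := ℝ))] with β hβ
  have hp0 : ∀ ω, 0 ≤ (1 - Real.exp (-(β * max (-X ω) 0))) / β := fun ω => by
    refine div_nonneg (sub_nonneg.2 (Real.exp_le_one_iff.2 ?_)) hβ.1.le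
    exact neg_nonpos.2 (mul_nonneg hβ.1.le (le_max_right _ _))
  have hpi : Integrable (fun ω => (1 - Real.exp (-(β * max (-X ω) 0))) / β) ρ := by
    refine Integrable.of_bound (by fun_prop) (1 / β) (ae_of_all _ fun ω => ?_)
    rw [Real.norm_of_nonneg (hp0 ω)]
    gcongr
    · exact hβ.1.le
    · linarith [Real.exp_pos (-(β * max (-X ω) 0))]
  have hmi : Integrable (fun ω => (Real.exp (β * max (X ω) 0) - 1) / β) ρ := by
    refine Integrable.div_const (Integrable.sub ?_ (integrable_const 1)) β
    refine ((integrable_const 1).add (integrable_exp_mul_of_mem_Icc hX hint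
      ⟨hβ.1.le, hβ.2⟩)).mono' (by fun_prop) (ae_of_all _ fun ω => ?_)
    rw [Real.norm_of_nonneg (Real.exp_pos _).le]
    simp only [Pi.add_apply]
    rcases max_choice (X ω) 0 with h | h
    · rw [h]; linarith
    · rw [h, mul_zero, Real.exp_zero]; linarith [Real.exp_pos (β * X ω)]
  have h5 : (∫⁻ ω, ENNReal.ofReal ((1 - Real.exp (-(β * max (-X ω) 0))) / β) ∂ρ : ENNReal) =
      ENNReal.ofReal (∫ ω, (1 - Real.exp (-(β * max (-X ω) 0))) / β ∂ρ) :=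
    (ofReal_integral_eq_lintegral_ofReal hpi (ae_of_all _ hp0)).symm
  have h6 : (1 - mgf X ρ β) / β = ∫ ω, (1 - Real.exp (-(β * max (-X ω) 0))) / β ∂ρ +
      -∫ ω, (Real.exp (β * max (X ω) 0) - 1) / β ∂ρ := by
    rw [← sub_eq_add_neg, ← integral_sub hpi hmi]
    have h7 : ∫ ω, (1 - Real.exp (β * X ω)) / β ∂ρ = (1 - mgf X ρ β) / β := by
      rw [integral_div, integral_sub (integrable_const 1)
        (integrable_exp_mul_of_mem_Icc hX hint ⟨hβ.1.le, hβ.2⟩)]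
      simp [mgf]
    rw [← h7]
    refine integral_congr_ae (ae_of_all _ fun ω => ?_)
    simp only
    rcases le_total (X ω) 0 with h | h
    · rw [max_eq_right h, max_eq_left (neg_nonneg.2 h)]
      simp
    · rw [max_eq_left h, max_eq_right (neg_nonpos.2 h)]
      simp [← neg_div]
  simp only [Function.comp_apply]
  rw [h5, EReal.coe_ennreal_ofReal, max_eq_left (integral_nonneg hp0), ← EReal.coe_add, ← h6]

/-! ### The cumulant generating function -/

theorem tendsto_mgf_nhdsGT_zero (hX : Measurable X)
    (hint : Integrable (fun ω => Real.exp (X ω)) ρ) : Tendsto (mgf X ρ) (𝓝[>] 0) (𝓝 1) := by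
  have h1 := (continuousOn_mgf_Icc hX hint 0 (by simp)).tendsto
  rw [mgf_zero] at h1
  refine h1.mono_left (nhdsWithin_le_iff.2 ?_)
  exact mem_of_superset (Ioc_mem_nhdsGT zero_lt_one) Ioc_subset_Icc_self

theorem tendsto_coe_mul_of_tendsto_one {f c : ℝ → ℝ} {l : Filter ℝ} {L : EReal}
    (hf : Tendsto (fun x => (f x : EReal)) l (𝓝 L)) (hc : Tendsto c l (𝓝 1)) :
    Tendsto (fun x => ((f x * c x : ℝ) : EReal)) l (𝓝 L) := by
  have h := (EReal.continuousAt_mul (p := (L, ((1 : ℝ) : EReal)))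
    (Or.inr (EReal.coe_ne_bot _)) (Or.inr (EReal.coe_ne_top _)) (Or.inr (by simp))
    (Or.inr (by simp))).tendsto.comp (hf.prodMk_nhds (EReal.tendsto_coe.2 hc))
  simp only [EReal.coe_one, mul_one] at h
  exact h.congr fun x => (EReal.coe_mul _ _).symm

/-- The right difference quotient at zero of the negative cumulant generating function, as an
extended real number. -/
theorem tendsto_neg_log_mgf_div (hX : Measurable X)
    (hint : Integrable (fun ω => Real.exp (X ω)) ρ) :
    Tendsto (fun β : ℝ => ((-Real.log (mgf X ρ β) / β : ℝ) : EReal)) (𝓝[>] 0)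
      (𝓝 (((∫⁻ ω, ENNReal.ofReal (-X ω) ∂ρ : ENNReal) : EReal) -
        ((∫⁻ ω, ENNReal.ofReal (X ω) ∂ρ : ENNReal) : EReal))) := by
  have h1 := tendsto_one_sub_mgf_div hX hint
  -- The logarithmic quotient is `(1 - m) / β` times the slope of `log` between `1` and `m = mgf X ρ
  -- β`. `dslope` also covers `m = 1`.
  have h2 : Tendsto (fun β => dslope Real.log 1 (mgf X ρ β)) (𝓝[>] 0) (𝓝 1) := by
    have h3 : ContinuousAt (dslope Real.log 1) 1 :=
      continuousAt_dslope_same.2 (Real.differentiableAt_log one_ne_zero)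
    have h4 := h3.tendsto.comp (tendsto_mgf_nhdsGT_zero hX hint)
    rwa [dslope_same, Real.deriv_log, inv_one] at h4
  refine (tendsto_coe_mul_of_tendsto_one h1 h2).congr fun β => ?_
  congr 1
  have h5 := sub_smul_dslope Real.log 1 (mgf X ρ β)
  rw [Real.log_one, sub_zero, smul_eq_mul] at h5
  rw [← h5]
  ring

/-- Lyapunov's inequality: Jensen for the convex power `γ / β` applied to `exp (β X)`. -/
theorem neg_log_mgf_div_le (hX : Measurable X)
    (hint : Integrable (fun ω => Real.exp (X ω)) ρ) {β γ : ℝ} (hβ : 0 < β) (hβγ : β ≤ γ)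
    (hγ : γ ≤ 1) : -Real.log (mgf X ρ γ) / γ ≤ -Real.log (mgf X ρ β) / β := by
  have hγ0 : 0 < γ := hβ.trans_le hβγ
  have hp : 1 ≤ γ / β := (one_le_div hβ).2 hβγ
  have hb := integrable_exp_mul_of_mem_Icc hX hint ⟨hβ.le, hβγ.trans hγ⟩
  have hc := integrable_exp_mul_of_mem_Icc hX hint ⟨hγ0.le, hγ⟩
  have hexp : ∀ ω, Real.exp (β * X ω) ^ (γ / β) = Real.exp (γ * X ω) := fun ω => by
    rw [← Real.exp_mul]
    congr 1
    field_simp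
  have h1 := (convexOn_rpow hp).map_integral_le (μ := ρ) (f := fun ω => Real.exp (β * X ω))
    (continuousOn_id.rpow_const fun x _ => Or.inr (by positivity)) isClosed_Ici
    (ae_of_all _ fun ω => (Real.exp_pos _).le) hb (hc.congr (ae_of_all _ fun ω => (hexp ω).symm))
  simp only [hexp] at h1
  have hm := mgf_pos_of_mem_Icc hX hint ⟨hβ.le, hβγ.trans hγ⟩
  have h2 : γ / β * Real.log (mgf X ρ β) ≤ Real.log (mgf X ρ γ) := by
    rw [← Real.log_rpow hm]
    exact Real.log_le_log (Real.rpow_pos_of_pos hm _) h1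
  rw [neg_div, neg_div, neg_le_neg_iff, le_div_iff₀ hγ0]
  calc Real.log (mgf X ρ β) / β * γ = γ / β * Real.log (mgf X ρ β) := by ring
    _ ≤ _ := h2

end BoundaryMGF

/-! ### Uniqueness of analytic continuations from a boundary line -/

section Strip

theorem strip_eq : strip = Complex.im ⁻¹' Ioo (-1) 0 := rfl

theorem isOpen_strip : IsOpen strip := isOpen_Ioo.preimage Complex.continuous_im

theorem isPreconnected_strip : IsPreconnected strip := by
  rw [strip_eq]
  exact ((convex_Ioo (-1 : ℝ) 0).linear_preimage Complex.imLm).isPreconnected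

theorem closure_strip : closure strip = Complex.im ⁻¹' Icc (-1) 0 := by
  rw [strip_eq, Complex.closure_preimage_im, closure_Ioo (by norm_num)]

/-- A function on the closed square that is holomorphic inside and vanishes on the top edge
vanishes. -/
theorem eqOn_zero_of_square {f : ℂ → ℂ}
    (hf : DiffContOnCl ℂ f (Ioo (-1) 1 ×ℂ Ioo (-1) 1))
    (h0 : ∀ z : ℂ, z.im = 1 → z.re ∈ Icc (-1 : ℝ) 1 → f z = 0) :
    EqOn f 0 (Ioo (-1) 1 ×ℂ Ioo (-1) 1) := by
  set Q : Set ℂ := Ioo (-1) 1 ×ℂ Ioo (-1) 1 with hQ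
  have hopen : IsOpen Q := isOpen_Ioo.reProdIm isOpen_Ioo
  have hcl : closure Q = Icc (-1) 1 ×ℂ Icc (-1) 1 := by
    rw [hQ, Complex.closure_reProdIm, closure_Ioo (by norm_num)]
  have hpre : IsPreconnected Q :=
    (((convex_Ioo (-1 : ℝ) 1).linear_preimage Complex.reLm).inter
      ((convex_Ioo (-1 : ℝ) 1).linear_preimage Complex.imLm)).isPreconnected
  have hbdd : Bornology.IsBounded Q :=
    (Metric.isBounded_Ioo _ _).reProdIm (Metric.isBounded_Ioo _ _)
  have hrot : ∀ {g : ℂ → ℂ}, DiffContOnCl ℂ g Q →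
      DiffContOnCl ℂ (fun z => g (Complex.I * z)) Q := by
    intro g hg
    refine hg.comp (g := fun z => Complex.I * z) ?_ ?_
    · exact (differentiable_id.const_mul Complex.I).diffContOnCl
    · intro z hz
      simp only [hQ, Complex.mem_reProdIm, mem_Ioo] at hz ⊢
      simp only [Complex.mul_re, Complex.mul_im, Complex.I_re, Complex.I_im]
      constructor <;> constructor <;> linarith [hz.1.1, hz.1.2, hz.2.1, hz.2.2]
  have h1 := hrot hf
  have h2 := hrot h1
  have h3 := hrot h2
  -- The four quarter turns carry every edge to the top edge, so the product vanishes on the whole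
  -- boundary and hence inside. By the identity theorem one factor vanishes, and its rotation can be
  -- undone.
  have hprod : DiffContOnCl ℂ (fun z => f z * f (Complex.I * z) *
      (f (Complex.I * (Complex.I * z)) * f (Complex.I * (Complex.I * (Complex.I * z))))) Q :=
    (hf.smul h1).smul (h2.smul h3)
  have hzero : EqOn (fun z => f z * f (Complex.I * z) *
      (f (Complex.I * (Complex.I * z)) * f (Complex.I * (Complex.I * (Complex.I * z)))))
      (fun _ => 0) Q := by
    refine Complex.eqOn_of_eqOn_frontier hbdd hprod diffContOnCl_const fun z hz => ?_
    have hz1 : z ∈ closure Q := hz.1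
    have hz2 : z ∉ Q := fun h => hz.2 (by rwa [hopen.interior_eq])
    rw [hcl] at hz1
    simp only [hQ, Complex.mem_reProdIm, mem_Ioo, mem_Icc, not_and_or, not_lt] at hz1 hz2
    obtain ⟨⟨ha, hb⟩, hc, hd⟩ := hz1
    have hcases : z.im = 1 ∨ z.re = 1 ∨ z.im = -1 ∨ z.re = -1 := by
      rcases hz2 with (h | h) | (h | h)
      · exact Or.inr (Or.inr (Or.inr (le_antisymm h ha)))
      · exact Or.inr (Or.inl (le_antisymm hb h))
      · exact Or.inr (Or.inr (Or.inl (le_antisymm h hc)))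
      · exact Or.inl (le_antisymm hd h)
    rcases hcases with h | h | h | h
    · have : f z = 0 := h0 _ h ⟨ha, hb⟩
      simp [this]
    · have : f (Complex.I * z) = 0 := h0 _ (by simpa using h)
        ⟨by simpa using hd, by simpa using neg_le.1 hc⟩
      simp [this]
    · have : f (Complex.I * (Complex.I * z)) = 0 := h0 _ (by simp [h])
        ⟨by simpa using hb, by simpa using neg_le.1 ha⟩
      simp [this]
    · have : f (Complex.I * (Complex.I * (Complex.I * z))) = 0 := h0 _ (by simp [h])
        ⟨by simpa using hc, by simpa using hd⟩
      simp [this]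
  have han : ∀ {g : ℂ → ℂ}, DiffContOnCl ℂ g Q → AnalyticOnNhd ℂ g Q := fun hg =>
    hg.differentiableOn.analyticOnNhd hopen
  have hback : ∀ {g : ℂ → ℂ}, (∀ z ∈ Q, g (Complex.I * z) = 0) → ∀ z ∈ Q, g z = 0 := by
    intro g hg z hz
    have hz' : -Complex.I * z ∈ Q := by
      simp only [hQ, Complex.mem_reProdIm, mem_Ioo] at hz ⊢
      simp only [Complex.mul_re, Complex.mul_im, Complex.neg_re, Complex.neg_im, Complex.I_re,
        Complex.I_im]
      constructor <;> constructor <;> linarith [hz.1.1, hz.1.2, hz.2.1, hz.2.2]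
    have h := hg _ hz'
    rwa [← mul_assoc, mul_neg, Complex.I_mul_I, neg_neg, one_mul] at h
  rcases AnalyticOnNhd.eq_zero_or_eq_zero_of_mul_eq_zero (han (hf.smul h1)) (han (h2.smul h3))
    hzero hpre with h | h
  · rcases AnalyticOnNhd.eq_zero_or_eq_zero_of_mul_eq_zero (han hf) (han h1) h hpre with h' | h'
    · exact h'
    · exact hback (g := f) h'
  · rcases AnalyticOnNhd.eq_zero_or_eq_zero_of_mul_eq_zero (han h2) (han h3) h hpre with h' | h'
    · exact hback (g := f) (hback (g := fun z => f (Complex.I * z)) h')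
    · exact hback (g := f) (hback (g := fun z => f (Complex.I * z))
        (hback (g := fun z => f (Complex.I * (Complex.I * z))) h'))

/-- A function that is continuous on the closed strip, holomorphic inside and zero on the real line
vanishes. -/
theorem eqOn_zero_of_strip {f : ℂ → ℂ} (hf : DiffContOnCl ℂ f strip) (h0 : ∀ t : ℝ, f t = 0) :
    EqOn f 0 (closure strip) := by
  -- This map sends the square into the strip and its top edge into the real line.
  have hmaps : MapsTo (fun w : ℂ => (w - Complex.I) / 2) (Ioo (-1) 1 ×ℂ Ioo (-1) 1) strip := by
    intro w hw
    simp only [Complex.mem_reProdIm, mem_Ioo] at hw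
    have him : ((w - Complex.I) / 2).im = (w.im - 1) / 2 := by simp
    constructor <;> rw [him] <;> linarith [hw.2.1, hw.2.2]
  have hsq : EqOn (fun w => f ((w - Complex.I) / 2)) 0 (Ioo (-1) 1 ×ℂ Ioo (-1) 1) := by
    refine eqOn_zero_of_square (hf.comp (g := fun w => (w - Complex.I) / 2)
      ((differentiable_id.sub_const _).div_const 2).diffContOnCl hmaps) fun z hz _ => ?_
    have h1 : (z - Complex.I) / 2 = ((z.re / 2 : ℝ) : ℂ) := by
      apply Complex.ext <;> simp [hz]
    rw [h1, h0]
  have hstrip : EqOn f 0 strip := by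
    have hmem : (-Complex.I / 2 : ℂ) ∈ strip := by
      constructor <;> norm_num
    refine (hf.differentiableOn.analyticOnNhd isOpen_strip
      ).eqOn_zero_of_preconnected_of_eventuallyEq_zero isPreconnected_strip hmem ?_
    have hopen : IsOpen (Ioo (-1) 1 ×ℂ Ioo (-1) 1) := isOpen_Ioo.reProdIm isOpen_Ioo
    have hcont : Continuous fun z : ℂ => 2 * z + Complex.I := by fun_prop
    have h1 : (fun z : ℂ => 2 * z + Complex.I) ⁻¹' (Ioo (-1) 1 ×ℂ Ioo (-1) 1) ∈
        𝓝 (-Complex.I / 2 : ℂ) := by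
      refine (hopen.preimage hcont).mem_nhds ?_
      have h2 : 2 * (-Complex.I / 2 : ℂ) + Complex.I = 0 := by ring
      rw [mem_preimage, h2]
      simp [Complex.mem_reProdIm]
    filter_upwards [h1] with z hz
    have h2 := hsq hz
    simpa using h2
  exact hstrip.of_subset_closure hf.continuousOn continuousOn_const subset_closure subset_rfl

end Strip

/-! ### Measures on the positive half-line with unit first moment -/

section HalfLine

open ProbabilityTheory

variable {μ : Measure ℝ}

theorem restrict_Ioi_eq_self (hpos : ∀ᵐ l ∂μ, 0 < l) : μ.restrict (Ioi 0) = μ :=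
  Measure.restrict_eq_self_of_ae_mem hpos

theorem integral_rpow_eq_mgf (hpos : ∀ᵐ l ∂μ, 0 < l) (r : ℝ) :
    ∫ l in Ioi (0 : ℝ), l ^ r ∂μ = mgf Real.log μ r := by
  rw [restrict_Ioi_eq_self hpos, mgf]
  refine integral_congr_ae (hpos.mono fun l hl => ?_)
  simp only
  rw [Real.rpow_def_of_pos hl, mul_comm]

theorem integral_cpow_eq_complexMGF (hpos : ∀ᵐ l ∂μ, 0 < l) (t : ℝ) :
    ∫ l in Ioi (0 : ℝ), (l : ℂ) ^ (Complex.I * t) ∂μ = complexMGF Real.log μ (Complex.I * t) := by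
  rw [restrict_Ioi_eq_self hpos, complexMGF]
  refine integral_congr_ae (hpos.mono fun l hl => ?_)
  simp only
  rw [Complex.cpow_def_of_ne_zero (Complex.ofReal_ne_zero.2 hl.ne'), Complex.ofReal_log hl.le,
    mul_comm]

theorem integrable_exp_log (hpos : ∀ᵐ l ∂μ, 0 < l) (hint : Integrable (fun l => l) μ) :
    Integrable (fun l => Real.exp (Real.log l)) μ :=
  hint.congr (hpos.mono fun _ hl => (Real.exp_log hl).symm)

theorem integrable_iff_lintegral_ofReal {Ω : Type*} [MeasurableSpace Ω] {ν : Measure Ω} {f : Ω → ℝ}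
    (hf : Measurable f) : Integrable f ν ↔
      ∫⁻ ω, ENNReal.ofReal (f ω) ∂ν ≠ ⊤ ∧ ∫⁻ ω, ENNReal.ofReal (-f ω) ∂ν ≠ ⊤ := by
  have h : ∀ ω, ‖f ω‖ₑ = ENNReal.ofReal (f ω) + ENNReal.ofReal (-f ω) := fun ω => by
    rw [← ofReal_norm, Real.norm_eq_abs]
    rcases le_total 0 (f ω) with h | h
    · rw [abs_of_nonneg h, ENNReal.ofReal_of_nonpos (neg_nonpos.2 h), add_zero]
    · rw [abs_of_nonpos h, ENNReal.ofReal_of_nonpos h, zero_add]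
  rw [← ENNReal.add_ne_top, ← lintegral_add_left (by fun_prop)]
  simp only [← h]
  exact ⟨fun hi => hi.2.ne, fun hi => ⟨hf.aestronglyMeasurable, hi.lt_top⟩⟩

/-- The measure `l dμ(l)`. -/
def sizeBiased (μ : Measure ℝ) : Measure ℝ := μ.withDensity fun l => ENNReal.ofReal l

theorem isProbabilityMeasure_sizeBiased (hpos : ∀ᵐ l ∂μ, 0 < l) (hint : Integrable (fun l => l) μ)
    (hone : ∫ l, l ∂μ = 1) : IsProbabilityMeasure (sizeBiased μ) := by
  refine ⟨?_⟩
  rw [sizeBiased, withDensity_apply _ MeasurableSet.univ, Measure.restrict_univ,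
    ← ofReal_integral_eq_lintegral_ofReal hint (hpos.mono fun _ hl => hl.le), hone,
    ENNReal.ofReal_one]

theorem integrable_sizeBiased_iff (hpos : ∀ᵐ l ∂μ, 0 < l) (f : ℝ → ℝ) :
    Integrable f (sizeBiased μ) ↔ Integrable (fun l => l * f l) μ := by
  rw [sizeBiased, integrable_withDensity_iff_integrable_smul' (by fun_prop)
    (ae_of_all _ fun t => by simp)]
  refine integrable_congr (hpos.mono fun l hl => ?_)
  simp [ENNReal.toReal_ofReal hl.le]

theorem integral_sizeBiased (hpos : ∀ᵐ l ∂μ, 0 < l) (f : ℝ → ℝ) :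
    ∫ l, f l ∂(sizeBiased μ) = ∫ l, l * f l ∂μ := by
  rw [sizeBiased, integral_withDensity_eq_integral_toReal_smul (by fun_prop)
    (ae_of_all _ fun t => by simp)]
  refine integral_congr_ae (hpos.mono fun l hl => ?_)
  simp [ENNReal.toReal_ofReal hl.le]

theorem lintegral_sizeBiased (hpos : ∀ᵐ l ∂μ, 0 < l) {f : ℝ → ℝ} (hf : Measurable f) :
    ∫⁻ l, ENNReal.ofReal (f l) ∂(sizeBiased μ) = ∫⁻ l, ENNReal.ofReal (l * f l) ∂μ := by
  rw [sizeBiased, lintegral_withDensity_eq_lintegral_mul _ (by fun_prop) (by fun_prop)]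
  refine lintegral_congr_ae (hpos.mono fun l hl => ?_)
  simp [ENNReal.ofReal_mul hl.le]

/-- Passing to `l dμ` and `-log` reflects the interval `[0, 1]`, so the endpoint `α = 0` is covered
by the results at the left endpoint. -/
theorem mgf_sizeBiased (hpos : ∀ᵐ l ∂μ, 0 < l) (r : ℝ) :
    mgf (fun l => -Real.log l) (sizeBiased μ) r = mgf Real.log μ (1 - r) := by
  rw [mgf, integral_sizeBiased hpos, mgf]
  refine integral_congr_ae (hpos.mono fun l hl => ?_)
  simp only
  nth_rewrite 1 [← Real.exp_log hl]
  rw [← Real.exp_add]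
  congr 1
  ring

theorem integrable_exp_neg_log_sizeBiased [IsFiniteMeasure μ] (hpos : ∀ᵐ l ∂μ, 0 < l) :
    Integrable (fun l => Real.exp (-Real.log l)) (sizeBiased μ) := by
  rw [integrable_sizeBiased_iff hpos]
  refine (integrable_const 1).congr (hpos.mono fun l hl => ?_)
  simp only
  rw [Real.exp_neg, Real.exp_log hl, mul_inv_cancel₀ hl.ne']

/-- The Rényi entropy of a measure, see `petzRenyi`. -/
def renyi (μ : Measure ℝ) (α : ℝ) : ℝ := (α - 1)⁻¹ * Real.log (mgf Real.log μ (1 - α))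

/-- The form of a difference quotient in `1 - α`. At `α = 1` both sides are `0` by the convention
for division by zero. -/
theorem renyi_eq (α : ℝ) : renyi μ α = -Real.log (mgf Real.log μ (1 - α)) / (1 - α) := by
  rw [renyi, ← neg_sub 1 α, inv_neg, div_eq_inv_mul]
  ring

theorem renyi_zero (hpos : ∀ᵐ l ∂μ, 0 < l) (hone : ∫ l, l ∂μ = 1) : renyi μ 0 = 0 := by
  have h1 : mgf Real.log μ 1 = 1 := by
    rw [mgf]
    refine Eq.trans ?_ hone
    exact integral_congr_ae (hpos.mono fun l hl => by simp [Real.exp_log hl])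
  rw [renyi, sub_zero, h1, Real.log_one, mul_zero]

variable [IsProbabilityMeasure μ]

theorem continuousOn_renyi (hpos : ∀ᵐ l ∂μ, 0 < l) (hint : Integrable (fun l => l) μ) :
    ContinuousOn (renyi μ) (Ico 0 1) := by
  have hmaps : MapsTo (fun α : ℝ => 1 - α) (Ico 0 1) (Icc 0 1) := fun α hα =>
    ⟨by linarith [hα.2], by linarith [hα.1]⟩
  have h1 : ContinuousOn (fun α => mgf Real.log μ (1 - α)) (Ico 0 1) :=
    (continuousOn_mgf_Icc Real.measurable_log (integrable_exp_log hpos hint)).comp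
      (by fun_prop) hmaps
  refine ContinuousOn.mul (ContinuousOn.inv₀ (by fun_prop) fun α hα => ?_) (h1.log fun α hα => ?_)
  · exact (sub_neg.2 hα.2).ne
  · exact (mgf_pos_of_mem_Icc Real.measurable_log (integrable_exp_log hpos hint) (hmaps hα)).ne'

theorem Ioo_subset_interior_integrableExpSet (hpos : ∀ᵐ l ∂μ, 0 < l)
    (hint : Integrable (fun l => l) μ) : Ioo 0 1 ⊆ interior (integrableExpSet Real.log μ) :=
  interior_maximal (fun _ hr => integrable_exp_mul_of_mem_Icc Real.measurable_log
    (integrable_exp_log hpos hint) (Ioo_subset_Icc_self hr)) isOpen_Ioo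

theorem differentiableOn_renyi (hpos : ∀ᵐ l ∂μ, 0 < l) (hint : Integrable (fun l => l) μ) :
    DifferentiableOn ℝ (renyi μ) (Ioo 0 1) := by
  intro α hα
  have hα' : 1 - α ∈ Ioo (0 : ℝ) 1 := ⟨by linarith [hα.2], by linarith [hα.1]⟩
  have h1 : DifferentiableAt ℝ (mgf Real.log μ) (1 - α) :=
    differentiableAt_mgf (Ioo_subset_interior_integrableExpSet hpos hint hα')
  have h2 : DifferentiableAt ℝ (fun α => mgf Real.log μ (1 - α)) α :=
    h1.comp α (by fun_prop)
  have h3 : DifferentiableAt ℝ (fun α : ℝ => (α - 1)⁻¹) α :=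
    DifferentiableAt.inv (by fun_prop) (sub_neg.2 hα.2).ne
  refine (h3.mul (h2.log ?_)).differentiableWithinAt
  exact (mgf_pos_of_mem_Icc Real.measurable_log (integrable_exp_log hpos hint)
    (Ioo_subset_Icc_self hα')).ne'

theorem tendsto_renyi_div (hpos : ∀ᵐ l ∂μ, 0 < l) (hint : Integrable (fun l => l) μ)
    (hone : ∫ l, l ∂μ = 1) :
    Tendsto (fun α : ℝ => (((renyi μ α - renyi μ 0) / α : ℝ) : EReal)) (𝓝[>] 0)
      (𝓝 (((∫⁻ l, ENNReal.ofReal (l * Real.log l) ∂μ : ENNReal) : EReal) -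
        ((∫⁻ l, ENNReal.ofReal (-(l * Real.log l)) ∂μ : ENNReal) : EReal))) := by
  have := isProbabilityMeasure_sizeBiased hpos hint hone
  have h1 := tendsto_neg_log_mgf_div (ρ := sizeBiased μ) (X := fun l => -Real.log l) (by fun_prop)
    (integrable_exp_neg_log_sizeBiased hpos)
  simp only [neg_neg] at h1
  rw [lintegral_sizeBiased hpos Real.measurable_log,
    lintegral_sizeBiased hpos (f := fun l => -Real.log l) (by fun_prop)] at h1
  simp only [mgf_sizeBiased hpos, mul_neg] at h1
  -- The prefactor of the entropy tends to `1`, and `renyi μ 0 = 0`, so only the logarithmic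
  -- quotient under `l dμ` matters.
  have h2 : Tendsto (fun α : ℝ => (1 - α)⁻¹) (𝓝[>] 0) (𝓝 1) := by
    have h3 : ContinuousAt (fun α : ℝ => (1 - α)⁻¹) 0 :=
      ContinuousAt.inv₀ (by fun_prop) (by norm_num)
    have h4 := h3.tendsto
    simp only [sub_zero, inv_one] at h4
    exact h4.mono_left nhdsWithin_le_nhds
  refine (tendsto_coe_mul_of_tendsto_one h1 h2).congr fun α => ?_
  congr 1
  rw [renyi_zero hpos hone, sub_zero, renyi_eq]
  ring

theorem lintegral_neg_mul_log_lt_top (hpos : ∀ᵐ l ∂μ, 0 < l) (hint : Integrable (fun l => l) μ)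
    (hone : ∫ l, l ∂μ = 1) : ∫⁻ l, ENNReal.ofReal (-(l * Real.log l)) ∂μ < ⊤ := by
  have := isProbabilityMeasure_sizeBiased hpos hint hone
  have h1 := lintegral_ofReal_lt_top (ρ := sizeBiased μ) (X := fun l => -Real.log l) (by fun_prop)
    (integrable_exp_neg_log_sizeBiased hpos)
  rw [lintegral_sizeBiased hpos (f := fun l => -Real.log l) (by fun_prop)] at h1
  simpa only [mul_neg] using h1

/-- The negative part of `l log l` always has finite integral, so the extended limit of the
quotients is finite exactly when `l log l` is integrable. -/
theorem differentiableWithinAt_renyi_zero_iff (hpos : ∀ᵐ l ∂μ, 0 < l)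
    (hint : Integrable (fun l => l) μ) (hone : ∫ l, l ∂μ = 1) :
    DifferentiableWithinAt ℝ (renyi μ) (Ico 0 1) 0 ↔
      Integrable (fun l => l * Real.log l) μ := by
  have hlim := tendsto_renyi_div hpos hint hone
  have hneg := lintegral_neg_mul_log_lt_top hpos hint hone
  have hset : 𝓝[Ico (0 : ℝ) 1 \ {0}] 0 = 𝓝[>] 0 := by
    rw [Ico_sdiff_left, nhdsWithin_Ioo_eq_nhdsGT zero_lt_one]
  have hslope : ∀ α, slope (renyi μ) 0 α = (renyi μ α - renyi μ 0) / α := fun α => by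
    rw [slope_def_field, sub_zero]
  rw [integrable_iff_lintegral_ofReal (by fun_prop : Measurable fun l : ℝ => l * Real.log l)]
  refine ⟨fun h => ⟨fun htop => ?_, hneg.ne⟩, fun h => ?_⟩
  · have h1 := h.hasDerivWithinAt
    rw [hasDerivWithinAt_iff_tendsto_slope, hset] at h1
    have h2 := tendsto_nhds_unique (EReal.tendsto_coe.2 (h1.congr hslope)) hlim
    rw [htop, ← EReal.coe_ennreal_toReal hneg.ne, EReal.coe_ennreal_top, EReal.top_sub_coe] at h2
    exact EReal.coe_ne_top _ h2
  · rw [← EReal.coe_ennreal_toReal h.1, ← EReal.coe_ennreal_toReal h.2, ← EReal.coe_sub,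
      EReal.tendsto_coe] at hlim
    have h1 := hlim.congr fun α => (hslope α).symm
    rw [← hset, ← hasDerivWithinAt_iff_tendsto_slope] at h1
    exact h1.differentiableWithinAt

/-- The relative entropy of a measure, see `arakiUhlmann`. -/
def logEntropy (μ : Measure ℝ) : EReal :=
  ((∫⁻ l, ENNReal.ofReal (-Real.log l) ∂μ : ENNReal) : EReal) -
    ((∫⁻ l, ENNReal.ofReal (Real.log l) ∂μ : ENNReal) : EReal)

theorem tendsto_renyi_one (hpos : ∀ᵐ l ∂μ, 0 < l) (hint : Integrable (fun l => l) μ) :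
    Tendsto (fun α : ℝ => (renyi μ α : EReal)) (𝓝[<] 1) (𝓝 (logEntropy μ)) := by
  have h1 := tendsto_neg_log_mgf_div (ρ := μ) Real.measurable_log (integrable_exp_log hpos hint)
  have h2 : Tendsto (fun α : ℝ => 1 - α) (𝓝[<] 1) (𝓝[>] 0) := by
    refine tendsto_nhdsWithin_iff.2 ⟨?_, ?_⟩
    · have h3 : ContinuousAt (fun α : ℝ => 1 - α) 1 := by fun_prop
      simpa using h3.tendsto.mono_left (nhdsWithin_le_nhds (s := Iio 1))
    · filter_upwards [self_mem_nhdsWithin] with α hα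
      exact sub_pos.2 (show α < 1 from hα)
  exact (h1.comp h2).congr fun α => by rw [renyi_eq]; rfl

theorem monotoneOn_renyi (hpos : ∀ᵐ l ∂μ, 0 < l) (hint : Integrable (fun l => l) μ) :
    MonotoneOn (renyi μ) (Ico 0 1) := by
  intro α hα β hβ hαβ
  rw [renyi_eq, renyi_eq]
  exact neg_log_mgf_div_le Real.measurable_log (integrable_exp_log hpos hint) (sub_pos.2 hβ.2)
    (by linarith) (by linarith [hα.1])

theorem renyi_le_logEntropy (hpos : ∀ᵐ l ∂μ, 0 < l) (hint : Integrable (fun l => l) μ) {α : ℝ}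
    (hα : α ∈ Ico (0 : ℝ) 1) : (renyi μ α : EReal) ≤ logEntropy μ := by
  refine ge_of_tendsto (tendsto_renyi_one hpos hint) ?_
  filter_upwards [Ioo_mem_nhdsLT hα.2] with β hβ
  exact EReal.coe_le_coe_iff.2
    (monotoneOn_renyi hpos hint hα ⟨hα.1.trans hβ.1.le, hβ.2⟩ hβ.1.le)

/-! ### The characteristic function of the logarithm in the strip -/

/-- On the closed strip `|exp (i z log l)| = exp (-Im z · log l)` with `-Im z` in `[0, 1]`, so `1 +
exp (log l)` dominates up to the boundary. -/
theorem diffContOnCl_complexMGF_log (hpos : ∀ᵐ l ∂μ, 0 < l) (hint : Integrable (fun l => l) μ) :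
    DiffContOnCl ℂ (fun z => complexMGF Real.log μ (Complex.I * z)) strip := by
  refine ⟨fun z hz => ?_, ?_⟩
  · have h1 : (Complex.I * z).re ∈ interior (integrableExpSet Real.log μ) := by
      refine Ioo_subset_interior_integrableExpSet hpos hint ?_
      simp only [Complex.mul_re, Complex.I_re, Complex.I_im]
      constructor <;> linarith [hz.1, hz.2]
    have h2 := (hasDerivAt_complexMGF h1).differentiableAt
    exact (h2.comp z (by fun_prop)).differentiableWithinAt
  · rw [closure_strip]
    refine continuousOn_of_dominated (bound := fun l => 1 + Real.exp (Real.log l))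
      (fun z _ => ?_) (fun z hz => ae_of_all _ fun l => ?_)
      ((integrable_const 1).add (integrable_exp_log hpos hint)) (ae_of_all _ fun l => ?_)
    · exact (by fun_prop : Measurable fun l : ℝ =>
        Complex.exp (Complex.I * z * (Real.log l : ℂ))).aestronglyMeasurable
    · have h1 : (Complex.I * z * (Real.log l : ℂ)).re = -z.im * Real.log l := by simp
      rw [Complex.norm_exp, h1]
      simp only [mem_preimage, mem_Icc] at hz
      exact exp_mul_le_one_add_exp (by linarith [hz.2]) (by linarith [hz.1]) _
    · fun_prop

end HalfLine

/-! ### Relative entropies -/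

namespace SpectralFamily

variable {E : SpectralFamily H} {T : H →ₗ.[ℂ] H}

/-- Uniqueness of the resolution makes the choice in `spectralMeasure` immaterial. -/
theorem IsResolutionOf.spectralMeasure_eq (hE : E.IsResolutionOf T) (x : H) :
    spectralMeasure T x = E.measure x := by
  have h : ∃ E : SpectralFamily H, E.IsResolutionOf T := ⟨E, hE⟩
  rw [spectralMeasure, dif_pos h, h.choose_spec.unique hE]

theorem IsResolutionOf.inner_functionalCalculus (hE : E.IsResolutionOf T) {g : ℝ → ℂ}
    (hg : IsBddMeasurable ((Ioi 0).indicator g)) (x : H) :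
    ⟪x, functionalCalculus T g x⟫ = ∫ l in Ioi (0 : ℝ), g l ∂(spectralMeasure T x) := by
  have h : ∃ U : H →L[ℂ] H, ∀ x, ⟪x, U x⟫ = ∫ l in Ioi (0 : ℝ), g l ∂(spectralMeasure T x) := by
    obtain ⟨U, hU⟩ := E.exists_represents hg
    refine ⟨U, fun x => ?_⟩
    rw [hU x, integral_indicator measurableSet_Ioi, hE.spectralMeasure_eq]
  rw [functionalCalculus, dif_pos h]
  exact h.choose_spec x

end SpectralFamily

theorem isBddMeasurable_indicator_cpow (t : ℝ) :
    IsBddMeasurable ((Ioi (0 : ℝ)).indicator fun l => (l : ℂ) ^ (Complex.I * t)) := by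
  refine ⟨Measurable.indicator (by fun_prop) measurableSet_Ioi, 1, fun l => ?_⟩
  by_cases hl : l ∈ Ioi (0 : ℝ)
  · rw [indicator_of_mem hl, Complex.norm_cpow_eq_rpow_re_of_pos hl]
    simp
  · rw [indicator_of_notMem hl, norm_zero]
    exact zero_le_one

section Modular

open ProbabilityTheory

variable {A : VonNeumannAlgebra H} {Ψ Φ : H}

theorem spectralMeasure_modularOperator_Iic_zero (hΨc : IsCyclic A Ψ) (hΨs : IsSeparating A Ψ)
    (hΦs : IsSeparating A Φ) (x : H) :
    spectralMeasure (modularOperator A Ψ Φ) x (Iic 0) = 0 := by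
  obtain ⟨E, hE⟩ := exists_isResolutionOf_modularOperator (Φ := Φ) hΨc hΨs
  rw [hE.spectralMeasure_eq]
  exact hE.measure_Iic_zero (modularOperator_inner_pos hΨc hΨs hΦs) x

theorem inner_modularFlow (hΨc : IsCyclic A Ψ) (hΨs : IsSeparating A Ψ) (t : ℝ) (x : H) :
    ⟪x, modularFlow A Ψ Φ t x⟫ = ∫ l in Ioi (0 : ℝ), (l : ℂ) ^ (Complex.I * t)
      ∂(spectralMeasure (modularOperator A Ψ Φ) x) := by
  obtain ⟨E, hE⟩ := exists_isResolutionOf_modularOperator (Φ := Φ) hΨc hΨs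
  exact hE.inner_functionalCalculus (isBddMeasurable_indicator_cpow t) x

theorem isProbabilityMeasure_modularMeasure (hΨc : IsCyclic A Ψ) (hΨs : IsSeparating A Ψ)
    (hΨ : ‖Ψ‖ = 1) : IsProbabilityMeasure (modularMeasure A Ψ Φ) := by
  obtain ⟨E, hE⟩ := exists_isResolutionOf_modularOperator (Φ := Φ) hΨc hΨs
  refine ⟨?_⟩
  rw [modularMeasure, hE.spectralMeasure_eq, E.measure_univ, hΨ]
  simp

theorem ae_modularMeasure_pos (hΨc : IsCyclic A Ψ) (hΨs : IsSeparating A Ψ)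
    (hΦs : IsSeparating A Φ) : ∀ᵐ l ∂(modularMeasure A Ψ Φ), 0 < l := by
  rw [ae_iff]
  simp only [not_lt]
  exact spectralMeasure_modularOperator_Iic_zero hΨc hΨs hΦs Ψ

theorem integral_modularMeasure (hΨc : IsCyclic A Ψ) (hΨs : IsSeparating A Ψ)
    (hΦs : IsSeparating A Φ) : Integrable (fun l => l) (modularMeasure A Ψ Φ) ∧
      ∫ l, l ∂(modularMeasure A Ψ Φ) = ‖Φ‖ ^ 2 := by
  obtain ⟨E, hE⟩ := exists_isResolutionOf_modularOperator (Φ := Φ) hΨc hΨs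
  -- Taking `a = 1` gives `S Ψ = Φ`.
  have h : (Ψ, Φ) ∈ tomitaGraph A Ψ Φ := by simpa using mem_tomitaGraph (one_mem A)
  rw [modularMeasure, hE.spectralMeasure_eq]
  exact integral_measure_of_mem_tomitaGraph hΨc hΨs hΦs hE h

theorem modularMoment_eq_mgf (hpos : ∀ᵐ l ∂(modularMeasure A Ψ Φ), 0 < l) (r : ℝ) :
    modularMoment A Ψ Φ r = mgf Real.log (modularMeasure A Ψ Φ) r :=
  integral_rpow_eq_mgf hpos r

theorem petzRenyi_eq_renyi (hpos : ∀ᵐ l ∂(modularMeasure A Ψ Φ), 0 < l) :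
    petzRenyi A Ψ Φ = renyi (modularMeasure A Ψ Φ) := by
  funext α
  rw [petzRenyi, modularMoment_eq_mgf hpos, renyi]

theorem arakiUhlmann_eq_logEntropy (hpos : ∀ᵐ l ∂(modularMeasure A Ψ Φ), 0 < l) :
    arakiUhlmann A Ψ Φ = logEntropy (modularMeasure A Ψ Φ) := by
  rw [arakiUhlmann, restrict_Ioi_eq_self hpos, logEntropy]

theorem petzRenyiExt_of_ne {α : ℝ} (hα : α ≠ 1) :
    petzRenyiExt A Ψ Φ α = (petzRenyi A Ψ Φ α : EReal) := if_neg hα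

theorem petzRenyi_zero (hpos : ∀ᵐ l ∂(modularMeasure A Ψ Φ), 0 < l)
    (hone : ∫ l, l ∂(modularMeasure A Ψ Φ) = 1) : petzRenyi A Ψ Φ 0 = 0 := by
  rw [petzRenyi_eq_renyi hpos]
  exact renyi_zero hpos hone

section Entropy

variable [IsProbabilityMeasure (modularMeasure A Ψ Φ)]

theorem integrableOn_rpow_modularMeasure (hpos : ∀ᵐ l ∂(modularMeasure A Ψ Φ), 0 < l)
    (hint : Integrable (fun l => l) (modularMeasure A Ψ Φ)) {r : ℝ} (hr : r ∈ Icc (0 : ℝ) 1) :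
    IntegrableOn (fun l : ℝ => l ^ r) (Ioi 0) (modularMeasure A Ψ Φ) := by
  rw [IntegrableOn, restrict_Ioi_eq_self hpos]
  refine (integrable_exp_mul_of_mem_Icc Real.measurable_log (integrable_exp_log hpos hint)
    hr).congr (hpos.mono fun l hl => ?_)
  simp only
  rw [Real.rpow_def_of_pos hl, mul_comm]

theorem modularMoment_pos (hpos : ∀ᵐ l ∂(modularMeasure A Ψ Φ), 0 < l)
    (hint : Integrable (fun l => l) (modularMeasure A Ψ Φ)) {r : ℝ} (hr : r ∈ Icc (0 : ℝ) 1) :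
    0 < modularMoment A Ψ Φ r := by
  rw [modularMoment_eq_mgf hpos]
  exact mgf_pos_of_mem_Icc Real.measurable_log (integrable_exp_log hpos hint) hr

theorem tendsto_petzRenyi_one (hpos : ∀ᵐ l ∂(modularMeasure A Ψ Φ), 0 < l)
    (hint : Integrable (fun l => l) (modularMeasure A Ψ Φ)) :
    Tendsto (fun α : ℝ => (petzRenyi A Ψ Φ α : EReal)) (𝓝[<] 1) (𝓝 (arakiUhlmann A Ψ Φ)) := by
  rw [arakiUhlmann_eq_logEntropy hpos, petzRenyi_eq_renyi hpos]
  exact tendsto_renyi_one hpos hint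

theorem petzRenyiExt_one (hpos : ∀ᵐ l ∂(modularMeasure A Ψ Φ), 0 < l)
    (hint : Integrable (fun l => l) (modularMeasure A Ψ Φ)) :
    petzRenyiExt A Ψ Φ 1 = arakiUhlmann A Ψ Φ := by
  rw [petzRenyiExt, if_pos rfl]
  exact (tendsto_petzRenyi_one hpos hint).limUnder_eq

theorem petzRenyiExt_le_arakiUhlmann (hpos : ∀ᵐ l ∂(modularMeasure A Ψ Φ), 0 < l)
    (hint : Integrable (fun l => l) (modularMeasure A Ψ Φ)) {α : ℝ} (hα : α ∈ Icc (0 : ℝ) 1) :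
    petzRenyiExt A Ψ Φ α ≤ arakiUhlmann A Ψ Φ := by
  rcases hα.2.eq_or_lt with rfl | h1
  · rw [petzRenyiExt_one hpos hint]
  · rw [petzRenyiExt_of_ne h1.ne, arakiUhlmann_eq_logEntropy hpos, petzRenyi_eq_renyi hpos]
    exact renyi_le_logEntropy hpos hint ⟨hα.1, h1⟩

theorem monotoneOn_petzRenyiExt (hpos : ∀ᵐ l ∂(modularMeasure A Ψ Φ), 0 < l)
    (hint : Integrable (fun l => l) (modularMeasure A Ψ Φ)) :
    MonotoneOn (petzRenyiExt A Ψ Φ) (Icc 0 1) := by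
  intro α hα β hβ hαβ
  rcases hβ.2.eq_or_lt with rfl | h1
  · rw [petzRenyiExt_one hpos hint]
    exact petzRenyiExt_le_arakiUhlmann hpos hint hα
  · have h2 := hαβ.trans_lt h1
    rw [petzRenyiExt_of_ne h1.ne, petzRenyiExt_of_ne h2.ne, petzRenyi_eq_renyi hpos]
    exact EReal.coe_le_coe_iff.2 (monotoneOn_renyi hpos hint ⟨hα.1, h2⟩ ⟨hβ.1, h1⟩ hαβ)

theorem petzRenyiExt_nonneg (hpos : ∀ᵐ l ∂(modularMeasure A Ψ Φ), 0 < l)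
    (hint : Integrable (fun l => l) (modularMeasure A Ψ Φ))
    (hone : ∫ l, l ∂(modularMeasure A Ψ Φ) = 1) {α : ℝ} (hα : α ∈ Icc (0 : ℝ) 1) :
    0 ≤ petzRenyiExt A Ψ Φ α := by
  have h := monotoneOn_petzRenyiExt hpos hint (left_mem_Icc.2 zero_le_one) hα hα.1
  rwa [petzRenyiExt_of_ne zero_ne_one, petzRenyi_zero hpos hone, EReal.coe_zero] at h

end Entropy

/-! ### Analytic continuation of the modular flow -/

theorem isFlowContinuation_complexMGF (hΨc : IsCyclic A Ψ) (hΨs : IsSeparating A Ψ)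
    (hΦs : IsSeparating A Φ) (hΨ : ‖Ψ‖ = 1) : IsFlowContinuation A Ψ Φ
      fun z => complexMGF Real.log (modularMeasure A Ψ Φ) (Complex.I * z) := by
  have := isProbabilityMeasure_modularMeasure (Φ := Φ) hΨc hΨs hΨ
  have hpos := ae_modularMeasure_pos hΨc hΨs hΦs
  refine ⟨diffContOnCl_complexMGF_log hpos (integral_modularMeasure hΨc hΨs hΦs).1, fun t => ?_⟩
  rw [inner_modularFlow hΨc hΨs]
  exact (integral_cpow_eq_complexMGF hpos t).symm

theorem IsFlowContinuation.eqOn {F G : ℂ → ℂ} (hF : IsFlowContinuation A Ψ Φ F)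
    (hG : IsFlowContinuation A Ψ Φ G) : EqOn F G (closure strip) := by
  have h := eqOn_zero_of_strip (hF.1.sub hG.1) fun t => by
    rw [Pi.sub_apply, hF.2, hG.2, sub_self]
  exact fun z hz => sub_eq_zero.1 (h hz)

/-- By uniqueness `F` is the explicit continuation on the closed strip, and `i · i (α - 1) = 1 - α`
is a real argument of the moment generating function. -/
theorem IsFlowContinuation.apply_eq_modularMoment (hΨc : IsCyclic A Ψ) (hΨs : IsSeparating A Ψ)
    (hΦs : IsSeparating A Φ) (hΨ : ‖Ψ‖ = 1) {F : ℂ → ℂ} (hF : IsFlowContinuation A Ψ Φ F) {α : ℝ}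
    (hα : α ∈ Icc (0 : ℝ) 1) :
    F (Complex.I * (α - 1)) = (modularMoment A Ψ Φ (1 - α) : ℂ) := by
  have hmem : Complex.I * ((α : ℂ) - 1) ∈ closure strip := by
    rw [closure_strip, mem_preimage]
    simp only [Complex.mul_im, Complex.I_re, Complex.I_im, Complex.sub_re, Complex.ofReal_re,
      Complex.one_re, zero_mul, one_mul, zero_add]
    exact ⟨by linarith [hα.1], by linarith [hα.2]⟩
  rw [hF.eqOn (isFlowContinuation_complexMGF hΨc hΨs hΦs hΨ) hmem]
  have h1 : Complex.I * (Complex.I * ((α : ℂ) - 1)) = ((1 - α : ℝ) : ℂ) := by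
    rw [← mul_assoc, Complex.I_mul_I]
    push_cast
    ring
  simp only
  rw [h1, complexMGF_ofReal, modularMoment_eq_mgf (ae_modularMeasure_pos hΨc hΨs hΦs)]

end Modular

end PetzRenyi

end

/-! ### The main theorem -/

theorem proposition1 {H : Type*} [NormedAddCommGroup H] [InnerProductSpace ℂ H] [CompleteSpace H]
    (A : VonNeumannAlgebra H) (Ψ Φ : H)
    (hΨc : PetzRenyi.IsCyclic A Ψ) (hΨs : PetzRenyi.IsSeparating A Ψ) (hΨ : ‖Ψ‖ = 1)
    (hΦc : PetzRenyi.IsCyclic A Φ) (hΦs : PetzRenyi.IsSeparating A Φ) (hΦ : ‖Φ‖ = 1) :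
    -- the closure of `a Ψ ↦ a† Φ` is an operator, and the relative modular operator has a unique
    -- spectral resolution, which is concentrated on the open half-line
    (∀ y, (0, y) ∈ PetzRenyi.tomitaGraph A Ψ Φ → y = 0) ∧
    (∃! E : PetzRenyi.SpectralFamily H, E.IsResolutionOf (PetzRenyi.modularOperator A Ψ Φ)) ∧
    (∀ x, PetzRenyi.spectralMeasure (PetzRenyi.modularOperator A Ψ Φ) x (Set.Iic 0) = 0) ∧
    -- the entropy is well defined for `α ∈ [0, 1]`
    (∀ α ∈ Set.Icc (0 : ℝ) 1,
      IntegrableOn (fun l : ℝ => l ^ (1 - α)) (Set.Ioi 0) (PetzRenyi.modularMeasure A Ψ Φ) ∧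
      0 < PetzRenyi.modularMoment A Ψ Φ (1 - α)) ∧
    -- regularity in `α`
    ContinuousOn (PetzRenyi.petzRenyi A Ψ Φ) (Set.Ico 0 1) ∧
    DifferentiableOn ℝ (PetzRenyi.petzRenyi A Ψ Φ) (Set.Ioo 0 1) ∧
    (DifferentiableWithinAt ℝ (PetzRenyi.petzRenyi A Ψ Φ) (Set.Ico 0 1) 0 ↔
      IntegrableOn (fun l : ℝ => l * Real.log l) (Set.Ioi 0)
        (PetzRenyi.modularMeasure A Ψ Φ)) ∧
    Tendsto (fun α : ℝ =>
        (((PetzRenyi.petzRenyi A Ψ Φ α - PetzRenyi.petzRenyi A Ψ Φ 0) / α : ℝ) : EReal))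
      (𝓝[>] 0)
      (𝓝 (((∫⁻ l in Set.Ioi (0 : ℝ), ENNReal.ofReal (l * Real.log l)
              ∂(PetzRenyi.modularMeasure A Ψ Φ) : ENNReal) : EReal) -
          ((∫⁻ l in Set.Ioi (0 : ℝ), ENNReal.ofReal (-(l * Real.log l))
              ∂(PetzRenyi.modularMeasure A Ψ Φ) : ENNReal) : EReal))) ∧
    -- value at `α = 0`, monotonicity, non-negativity
    PetzRenyi.petzRenyi A Ψ Φ 0 = 0 ∧
    MonotoneOn (PetzRenyi.petzRenyiExt A Ψ Φ) (Set.Icc 0 1) ∧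
    (∀ α ∈ Set.Icc (0 : ℝ) 1, 0 ≤ PetzRenyi.petzRenyiExt A Ψ Φ α) ∧
    -- the limit `α → 1⁻` is the (well defined) Araki–Uhlmann relative entropy, an upper bound
    (∫⁻ l in Set.Ioi (0 : ℝ), ENNReal.ofReal (Real.log l) ∂(PetzRenyi.modularMeasure A Ψ Φ)) < ⊤ ∧
    Tendsto (fun α : ℝ => (PetzRenyi.petzRenyi A Ψ Φ α : EReal)) (𝓝[<] 1)
      (𝓝 (PetzRenyi.arakiUhlmann A Ψ Φ)) ∧
    PetzRenyi.petzRenyiExt A Ψ Φ 1 = PetzRenyi.arakiUhlmann A Ψ Φ ∧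
    (∀ α ∈ Set.Icc (0 : ℝ) 1,
      PetzRenyi.petzRenyiExt A Ψ Φ α ≤ PetzRenyi.arakiUhlmann A Ψ Φ) ∧
    -- the modular flow exists, and has a unique analytic continuation, which gives the entropy
    (∀ (t : ℝ) (x : H), ⟪x, PetzRenyi.modularFlow A Ψ Φ t x⟫ =
      ∫ l in Set.Ioi (0 : ℝ), (l : ℂ) ^ (Complex.I * t)
        ∂(PetzRenyi.spectralMeasure (PetzRenyi.modularOperator A Ψ Φ) x)) ∧
    (∃ F : ℂ → ℂ, PetzRenyi.IsFlowContinuation A Ψ Φ F) ∧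
    (∀ F G : ℂ → ℂ, PetzRenyi.IsFlowContinuation A Ψ Φ F →
      PetzRenyi.IsFlowContinuation A Ψ Φ G → Set.EqOn F G (closure PetzRenyi.strip)) ∧
    (∀ F : ℂ → ℂ, PetzRenyi.IsFlowContinuation A Ψ Φ F →
      (∀ α ∈ Set.Icc (0 : ℝ) 1, F (Complex.I * (α - 1)) =
        (PetzRenyi.modularMoment A Ψ Φ (1 - α) : ℂ)) ∧
      ∀ α ∈ Set.Ico (0 : ℝ) 1, (PetzRenyi.petzRenyi A Ψ Φ α : ℂ) =
        ((α : ℂ) - 1)⁻¹ * Complex.log (F (Complex.I * (α - 1)))) := by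
  have := PetzRenyi.isProbabilityMeasure_modularMeasure (Φ := Φ) hΨc hΨs hΨ
  have hpos := PetzRenyi.ae_modularMeasure_pos hΨc hΨs hΦs
  obtain ⟨hint, hone⟩ := PetzRenyi.integral_modularMeasure hΨc hΨs hΦs
  rw [hΦ, one_pow] at hone
  have hmem : ∀ α ∈ Set.Icc (0 : ℝ) 1, 1 - α ∈ Set.Icc (0 : ℝ) 1 := fun α hα =>
    ⟨sub_nonneg.2 hα.2, sub_le_self 1 hα.1⟩
  refine ⟨fun y => PetzRenyi.tomitaGraph_snd_eq_zero hΨs, ?_,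
    PetzRenyi.spectralMeasure_modularOperator_Iic_zero hΨc hΨs hΦs,
    fun α hα => ⟨PetzRenyi.integrableOn_rpow_modularMeasure hpos hint (hmem α hα),
      PetzRenyi.modularMoment_pos hpos hint (hmem α hα)⟩, ?_, ?_, ?_, ?_,
    PetzRenyi.petzRenyi_zero hpos hone, PetzRenyi.monotoneOn_petzRenyiExt hpos hint,
    fun α hα => PetzRenyi.petzRenyiExt_nonneg hpos hint hone hα, ?_,
    PetzRenyi.tendsto_petzRenyi_one hpos hint, PetzRenyi.petzRenyiExt_one hpos hint,
    fun α hα => PetzRenyi.petzRenyiExt_le_arakiUhlmann hpos hint hα,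
    PetzRenyi.inner_modularFlow hΨc hΨs,
    ⟨_, PetzRenyi.isFlowContinuation_complexMGF hΨc hΨs hΦs hΨ⟩,
    fun F G hF hG => hF.eqOn hG, fun F hF =>
      ⟨fun α hα => hF.apply_eq_modularMoment hΨc hΨs hΦs hΨ hα, fun α hα => ?_⟩⟩
  · obtain ⟨E, hE⟩ := PetzRenyi.exists_isResolutionOf_modularOperator (Φ := Φ) hΨc hΨs
    exact ⟨E, hE, fun F hF => hF.unique hE⟩
  · rw [PetzRenyi.petzRenyi_eq_renyi hpos]
    exact PetzRenyi.continuousOn_renyi hpos hint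
  · rw [PetzRenyi.petzRenyi_eq_renyi hpos]
    exact PetzRenyi.differentiableOn_renyi hpos hint
  · rw [PetzRenyi.petzRenyi_eq_renyi hpos, IntegrableOn, PetzRenyi.restrict_Ioi_eq_self hpos]
    exact PetzRenyi.differentiableWithinAt_renyi_zero_iff hpos hint hone
  · rw [PetzRenyi.petzRenyi_eq_renyi hpos, PetzRenyi.restrict_Ioi_eq_self hpos]
    exact PetzRenyi.tendsto_renyi_div hpos hint hone
  · rw [PetzRenyi.restrict_Ioi_eq_self hpos]
    exact PetzRenyi.lintegral_ofReal_lt_top Real.measurable_log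
      (PetzRenyi.integrable_exp_log hpos hint)
  · have hα' := Set.Ico_subset_Icc_self hα
    rw [hF.apply_eq_modularMoment hΨc hΨs hΦs hΨ hα', ← Complex.ofReal_log
      (PetzRenyi.modularMoment_pos hpos hint (hmem α hα')).le, PetzRenyi.petzRenyi]
    push_cast
    rfl
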